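/- **Definitions.** All graphs are finite and simple. For a graph $H$ and $k\ge 2$, the edge blow-up $H^{k}$ is obtained from $H$ by replacing each edge by a clique on $k$ vertices (containing the two ends of the edge), where the new vertices of the cliques are all distinct. $G\cup H$ is the disjoint union and $G+H$ the join of $G$ and $H$; $I_v=\overline K_v$ is the edgeless graph on $v$ vertices; $T(n,r)$ is the $r$-partite Turán graph on $n$ vertices; $\alpha$ is the independence number; $\delta_T(A)=\min\{\deg_T(x): x\in A\}$. For a family $\mathcal F$ of graphs, $\mathrm{ex}(n,\mathcal F)$ is the maximum number of edges of a graph on $n$ vertices that contains no member of $\mathcal F$ as a (not necessarily induced) subgraph, and $\mathrm{EX}(n,\mathcal F)$ is the set of such graphs with exactly $\mathrm{ex}(n,\mathcal F)$ edges; for a single graph $L$ we write $\mathrm{ex}(n,L)$ and $\mathrm{EX}(n,L)$. For a graph $L$ with chromatic number $\chi(L)\ge 3$, the decomposition family $\mathcal M(L)$ consists of the graphs $M$ that are minimal, with respect to the subgraph relation, with the property that $L$ is a subgraph of $(M\cup I_v)+T(t,\chi(L)-2)$ for some $v$ and $t$. A covering of a graph is a set of vertices meeting every edge. For a bipartite graph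 $F$, $q(F)$ is the minimum size of a covering of $F$ that is an independent set, and for a family $\mathcal F$ containing a bipartite graph, $q(\mathcal F)=\min\{q(F): F\in\mathcal F,\ F\text{ bipartite}\}$. **Theorem.** Let $p\ge 3$ be an integer and let $T$ be a tree with colour classes $A$ and $B$, $|A|\le|B|$, such that $\delta_T(A)=1$ and $\alpha(T)>|B|$. Put $\mathcal M=\mathcal M(T^{p+1})$ (note $\chi(T^{p+1})=p+1$) and $q=q(\mathcal M)$. If some member of $\mathcal M$ has a covering with at most $q-1$ vertices, let $\mathcal B$ be the family of all induced subgraphs $F[U]$, where $F\in\mathcal M$ and $U$ is a covering of $F$ with $|U|\le q-1$; otherwise let $\mathcal B=\{K_q\}$. Let $h'(n,p,q)$ be the number of edges of $H'(n,p,q)=\overline K_{q-1}+T(n-q+1,p)$. Then there is an $n_0$ (depending on $p$ and $T$) such that for all $n\ge n_0$ $$\mathrm{ex}(n,T^{p+1})=h'(n,p,q)+\mathrm{ex}(q-1,\mathcal B),$$ and a graph $G$ on $n$ vertices belongs to $\mathrm{EX}(n,T^{p+1})$ if and only if $G$ is isomorphic to a graph obtained from $H'(n,p,q)$ by embedding some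 $Q\in\mathrm{EX}(q-1,\mathcal B)$ in its part $\overline K_{q-1}$, that is, to $Q+T(n-q+1,p)$. -/

import Mathlib

noncomputable section

namespace BlowupTuran

open scoped SimpleGraph

/-- The join of two vertex-disjoint graphs: their disjoint union together with all edges
between them. -/
def join {V W : Type*} (G : SimpleGraph V) (H : SimpleGraph W) : SimpleGraph (V ⊕ W) :=
  (G ⊕g H) ⊔ completeBipartiteGraph V W

/-- The vertex set of the clique of the edge blow-up of `H` that replaces the edge `e`: the two
ends of `e` and the `k - 2` new vertices that belong to `e`. -/
def blowupClique {V : Type*} (H : SimpleGraph V) (k : ℕ) (e : H.edgeSet) :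
    Set (V ⊕ H.edgeSet × Fin (k - 2)) :=
  {x | (∃ v ∈ (e : Sym2 V), x = Sum.inl v) ∨ ∃ i, x = Sum.inr (e, i)}

/-- The edge blow-up `H^k` (for `k ≥ 2`): every edge of `H` is replaced by a clique on `k`
vertices, where the new vertices of the cliques are all distinct. -/
def edgeBlowup {V : Type*} (H : SimpleGraph V) (k : ℕ) :
    SimpleGraph (V ⊕ H.edgeSet × Fin (k - 2)) where
  Adj x y := x ≠ y ∧ ∃ e : H.edgeSet, x ∈ blowupClique H k e ∧ y ∈ blowupClique H k e
  symm := ⟨fun _ _ h => ⟨h.1.symm, h.2.imp fun _ he => ⟨he.2, he.1⟩⟩⟩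
  loopless := ⟨fun _ h => h.1 rfl⟩

/-- `δ_H(A)`, the minimum degree in `H` of the vertices in `A`. -/
def minDegreeOn {V : Type*} (H : SimpleGraph V) (A : Set V) : ℕ :=
  sInf ((fun x => (H.neighborSet x).ncard) '' A)

/-- A family of finite graphs. -/
abbrev GraphFamily : Type := Set (Σ m : ℕ, SimpleGraph (Fin m))

/-- `G` contains no copy of a member of `𝓕` as a (not necessarily induced) subgraph. -/
def FamilyFree {V : Type*} (𝓕 : GraphFamily) (G : SimpleGraph V) : Prop :=
  ∀ F ∈ 𝓕, F.2.Free G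

/-- `ex(n, 𝓕)`, the maximum number of edges of an `𝓕`-free graph on `n` vertices. -/
def familyEx (n : ℕ) (𝓕 : GraphFamily) : ℕ :=
  sSup {e | ∃ G : SimpleGraph (Fin n), FamilyFree 𝓕 G ∧ G.edgeSet.ncard = e}

/-- `EX(n, 𝓕)`, the `𝓕`-free graphs on `n` vertices with `ex(n, 𝓕)` edges. -/
def familyEX (n : ℕ) (𝓕 : GraphFamily) : Set (SimpleGraph (Fin n)) :=
  {G | FamilyFree 𝓕 G ∧ G.edgeSet.ncard = familyEx n 𝓕}

/-- `EX(n, L)`, the `L`-free graphs on `n` vertices with `ex(n, L)` edges. -/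
def graphEX {W : Type*} (n : ℕ) (L : SimpleGraph W) : Set (SimpleGraph (Fin n)) :=
  {G | L.Free G ∧ G.edgeSet.ncard = SimpleGraph.extremalNumber n L}

/-- `L` is a subgraph of `(M ∪ I_v) + T(t, χ(L) - 2)` for some `v` and `t`, where `I_v` is the
edgeless graph on `v` vertices and `T(t, r)` the Turán graph. (Meant for `χ(L) ≥ 3`.) -/
def Decomposes {W : Type*} (L : SimpleGraph W) {m : ℕ} (M : SimpleGraph (Fin m)) : Prop :=
  ∃ v t : ℕ, L ⊑ join (M ⊕g (⊥ : SimpleGraph (Fin v)))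
    (SimpleGraph.turanGraph t (L.chromaticNumber.toNat - 2))

/-- The decomposition family `𝓜(L)`: the graphs `M` that are minimal, with respect to the
subgraph relation, with the property `Decomposes L M`. -/
def decompositionFamily {W : Type*} (L : SimpleGraph W) : GraphFamily :=
  {M | Decomposes L M.2 ∧
    ∀ M' : Σ m : ℕ, SimpleGraph (Fin m), Decomposes L M'.2 → M'.2 ⊑ M.2 → M.2 ⊑ M'.2}

/-- `q(F)` for a bipartite graph `F`: the minimum order of an independent covering. -/
def indepCoverNum {V : Type*} (F : SimpleGraph V) : ℕ :=
  sInf {k | ∃ U : Finset V, F.IsVertexCover (U : Set V) ∧ F.IsIndepSet (U : Set V) ∧ U.card = k}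

/-- `q(𝓕)`: the minimum of `q(F)` over the bipartite members `F` of `𝓕`. -/
def familyIndepCoverNum (𝓕 : GraphFamily) : ℕ :=
  sInf {k | ∃ F ∈ 𝓕, F.2.IsBipartite ∧ indepCoverNum F.2 = k}

open Classical in
/-- The family `𝓑` attached to `𝓜`, where `q = q(𝓜)`: all graphs induced by a member of `𝓜` on a
covering of it with fewer than `q` vertices if some member has such a covering, and `{K_q}`
otherwise. -/
def coveringFamily (𝓜 : GraphFamily) : GraphFamily :=
  if ∃ F ∈ 𝓜, F.2.vertexCoverNum < (familyIndepCoverNum 𝓜 : ℕ∞) then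
    {Q | ∃ F ∈ 𝓜, ∃ U : Finset (Fin F.1), F.2.IsVertexCover (U : Set (Fin F.1)) ∧
      U.card < familyIndepCoverNum 𝓜 ∧ Nonempty (Q.2 ≃g F.2.induce (U : Set (Fin F.1)))}
  else {⟨familyIndepCoverNum 𝓜, ⊤⟩}

/-- The graph obtained from `H'(n, p, q)` by embedding `Q` in its part `K̄_{q-1}`, that is, the
join of `Q` and the Turán graph `T(n - q + 1, p)`. -/
def turanWith (n p q : ℕ) (Q : SimpleGraph (Fin (q - 1))) :
    SimpleGraph (Fin (q - 1) ⊕ Fin (n - (q - 1))) :=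
  join Q (SimpleGraph.turanGraph (n - (q - 1)) p)

/-- `h'(n, p, q)`, the number of edges of `H'(n, p, q) = K̄_{q-1} + T(n - q + 1, p)`. -/
def hPrime (n p q : ℕ) : ℕ :=
  (turanWith n p q ⊥).edgeSet.ncard

end BlowupTuran

end

open BlowupTuran

/-! Write `L` for the blow-up, `p = m + 1` and `r = q - 1`, so that `L` has chromatic number `m +
2`. Only a few facts about `L` are needed.

First, `L` embeds into the join of a matching with a complete `m`-partite graph
(`edgeBlowup_isContained_join_matching`). Second, it embeds into the join of `r` stars and one extra
edge with such a graph (`edgeBlowup_isContained_join_starForest`). Indeed, an independent covering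
of size `q` of a member of `𝓜` traces an independent set `C` of `T` for which `|C|` plus the number
of edges missing `C` is at most `q`. Vertices of `C` become centres of stars, and each missed edge
becomes a single edge. If no edge is missed, `C` is a colour class of `T`, and `A` is at most as
large and contains a leaf; so one of the `q` stars may always be taken to be an edge
(`exists_indepSet_special`). Third, a graph `Q` on `r` vertices avoids `𝓑` exactly when its joins
with complete `(m + 1)`-partite graphs avoid `L` (`familyFree_of_free_join`,
`free_join_of_familyFree`).

The rest is Simonovits' progressive induction (`extremal_of_starForest`). Let `h n` be the
conjectured extremal number. If some extremal graph has a vertex of small degree or a `K_{m+1}` of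
small degree sum, deleting it increases `ex - h`; this excess cannot increase all the way down from
a large `n`. If all extremal graphs meet both degree conditions, `exists_structure` provides `r`
vertices `X` such that `G - X` is `(m + 1)`-partite and `G[X]` joined to a large complete `(m +
1)`-partite graph lies in `G`; then `G[X]` avoids `𝓑`, and Turán's theorem bounds the rest.

For the structure, Erdős–Stone gives a complete `(m + 1)`-partite subgraph, and the first embedding
turns the vertices attached to it into almost independent classes (`exists_nearPartition`). By the
second embedding only boundedly many vertices see much of every class. The clique condition forces
exactly `r` of them, joined to almost everything, and then no edge can lie inside a class of the
remaining vertices. -/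

namespace BlowupTuran

open SimpleGraph Finset
open scoped Classical

section

/-! ### Star forests, joins and their copies -/

/-- The disjoint union of `r` stars with `s` leaves each; the vertex `(i, none)` is the center of
the `i`-th star. -/
def starForest (r s : ℕ) : SimpleGraph (Fin r × Option (Fin s)) where
  Adj a b := a.1 = b.1 ∧ (a.2 = none ∧ b.2 ≠ none ∨ a.2 ≠ none ∧ b.2 = none)
  symm := ⟨fun _ _ h => ⟨h.1.symm, h.2.symm.imp And.symm And.symm⟩⟩
  loopless := ⟨fun _ h => by rcases h.2 with h | h <;> tauto⟩

section Join

variable {V V' W W' : Type*} {G : SimpleGraph V} {G' : SimpleGraph V'} {H : SimpleGraph W}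
  {H' : SimpleGraph W'}

@[simp] lemma join_adj_inl_inl {a b : V} : (join G H).Adj (.inl a) (.inl b) ↔ G.Adj a b := by
  simp [join]

@[simp] lemma join_adj_inr_inr {a b : W} : (join G H).Adj (.inr a) (.inr b) ↔ H.Adj a b := by
  simp [join]

@[simp] lemma join_adj_inl_inr {a : V} {b : W} : (join G H).Adj (.inl a) (.inr b) := by
  simp [join]

@[simp] lemma join_adj_inr_inl {a : W} {b : V} : (join G H).Adj (.inr a) (.inl b) := by
  simp [join]

lemma join_isContained_join (h : G ⊑ G') (h' : H ⊑ H') : join G H ⊑ join G' H' := by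
  obtain ⟨f⟩ := h
  obtain ⟨g⟩ := h'
  refine ⟨⟨⟨Sum.map f g, ?_⟩, Sum.map_injective.2 ⟨f.injective, g.injective⟩⟩⟩
  rintro (a | a) (b | b) hab
  · simpa using f.toHom.map_adj (by simpa using hab)
  · simp
  · simp
  · simpa using g.toHom.map_adj (by simpa using hab)

/-- A copy of `M` together with pairwise completely joined classes in the common neighbourhood of
that copy yields a copy of the join of `M` with a complete equipartite graph. -/
lemma join_equipartite_isContained {M : SimpleGraph W} {r s : ℕ} (f : Copy M G)
    (D : Fin r → Finset V) (hcard : ∀ j, s ≤ (D j).card)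
    (hD : ∀ i j, i ≠ j → ∀ u ∈ D i, ∀ v ∈ D j, G.Adj u v)
    (hf : ∀ j, ∀ d ∈ D j, ∀ w, G.Adj (f w) d) :
    join M (completeEquipartiteGraph r s) ⊑ G := by
  have hg : ∀ j, ∃ g : Fin s → V, Function.Injective g ∧ ∀ i, g i ∈ D j := by
    intro j
    obtain ⟨D', hD', hs⟩ := Finset.exists_subset_card_eq (hcard j)
    refine ⟨fun i => (D'.equivFinOfCardEq hs).symm i, ?_, fun i => hD' (Subtype.prop _)⟩
    intro a b hab
    simpa using Subtype.ext hab
  choose g hg hgD using hg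
  refine ⟨⟨⟨Sum.elim f fun x => g x.1 x.2, ?_⟩, ?_⟩⟩
  · rintro (a | a) (b | b) hab
    · exact f.toHom.map_adj (by simpa using hab)
    · exact hf _ _ (hgD _ _) _
    · exact (hf _ _ (hgD _ _) _).symm
    · exact hD _ _ (by simpa using hab) _ (hgD _ _) _ (hgD _ _)
  · rintro (a | ⟨a, a'⟩) (b | ⟨b, b'⟩) hab
    · exact congrArg _ (f.injective hab)
    · exact absurd hab (hf _ _ (hgD _ _) _).ne
    · exact absurd hab.symm (hf _ _ (hgD _ _) _).ne
    · by_cases h : a = b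
      · subst h
        simpa using hg a hab
      · exact absurd hab (hD _ _ h _ (hgD _ _) _ (hgD _ _)).ne

/-- Almost completely joined classes contain completely joined classes. -/
lemma exists_complete_classes {δ s : ℕ} : ∀ {r : ℕ} (D : Fin r → Finset V),
    (∀ j, r * (s * δ) + s ≤ (D j).card) →
    (∀ i j, i ≠ j → ∀ u ∈ D i, ((D j).filter fun v => ¬ G.Adj u v).card ≤ δ) →
    ∃ D' : Fin r → Finset V, (∀ j, D' j ⊆ D j) ∧ (∀ j, (D' j).card = s) ∧
      ∀ i j, i ≠ j → ∀ u ∈ D' i, ∀ v ∈ D' j, G.Adj u v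
  | 0, _, _, _ => ⟨fun _ => ∅, fun j => j.elim0, fun j => j.elim0, fun j => j.elim0⟩
  | r + 1, D, hcard, hD => by
    -- Greedy choice: any `s` vertices of the last class serve, since together they exclude at most
    -- `s * δ` vertices of each other class.
    obtain ⟨A, hA, hAs⟩ := Finset.exists_subset_card_eq
      ((Nat.le_add_left _ _).trans (hcard (Fin.last r)))
    let E : Fin r → Finset V := fun j => (D j.castSucc).filter fun v => ∀ u ∈ A, G.Adj u v
    have hE : ∀ j, r * (s * δ) + s ≤ (E j).card := by
      intro j
      have h1 : (D j.castSucc) ⊆ E j ∪ A.biUnion fun u =>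
          (D j.castSucc).filter fun v => ¬ G.Adj u v := by
        intro v hv
        by_cases h : ∀ u ∈ A, G.Adj u v
        · exact Finset.mem_union_left _ (Finset.mem_filter.2 ⟨hv, h⟩)
        · push Not at h
          obtain ⟨u, hu, huv⟩ := h
          exact Finset.mem_union_right _ (Finset.mem_biUnion.2
            ⟨u, hu, Finset.mem_filter.2 ⟨hv, huv⟩⟩)
      have h2 : (A.biUnion fun u => (D j.castSucc).filter fun v => ¬ G.Adj u v).card
          ≤ A.card * δ :=
        Finset.card_biUnion_le_card_mul _ _ _ fun u hu =>
          hD _ _ (Fin.castSucc_lt_last j).ne' u (hA hu)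
      have h3 := (Finset.card_le_card h1).trans (Finset.card_union_le _ _)
      have h4 := hcard j.castSucc
      rw [hAs] at h2
      rw [Nat.succ_mul] at h4
      omega
    obtain ⟨D', h1, h2, h3⟩ := exists_complete_classes E hE fun i j hij u hu =>
      (Finset.card_le_card (Finset.filter_subset_filter _ (Finset.filter_subset _ _))).trans
        (hD i.castSucc j.castSucc (by simpa using hij) u (Finset.mem_of_mem_filter u hu))
    refine ⟨Fin.snoc D' A, fun j => ?_, fun j => ?_, fun i j => ?_⟩
    · refine Fin.lastCases ?_ (fun j => ?_) j
      · simpa using hA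
      · simpa using (h1 j).trans (Finset.filter_subset _ _)
    · refine Fin.lastCases ?_ (fun j => ?_) j
      · simpa using hAs
      · simpa using h2 j
    · refine Fin.lastCases ?_ (fun i => ?_) i <;> refine Fin.lastCases ?_ (fun j => ?_) j
      · simp
      · intro _ u hu v hv
        simp only [Fin.snoc_last, Fin.snoc_castSucc] at hu hv
        exact (Finset.mem_filter.1 (h1 j hv)).2 u hu
      · intro _ u hu v hv
        simp only [Fin.snoc_last, Fin.snoc_castSucc] at hu hv
        exact ((Finset.mem_filter.1 (h1 i hu)).2 v hv).symm
      · intro hij u hu v hv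
        simp only [Fin.snoc_castSucc] at hu hv
        exact h3 i j (by simpa using hij) u hu v hv

/-- The analogue of `join_equipartite_isContained` for almost completely joined classes. -/
lemma join_equipartite_isContained_of_near {M : SimpleGraph W} {r s δ : ℕ} (f : Copy M G)
    (D : Fin r → Finset V)
    (hcard : ∀ j, ∃ D' ⊆ D j, (∀ d ∈ D', ∀ w, G.Adj (f w) d) ∧ r * (s * δ) + s ≤ D'.card)
    (hD : ∀ i j, i ≠ j → ∀ u ∈ D i, ((D j).filter fun v => ¬ G.Adj u v).card ≤ δ) :
    join M (completeEquipartiteGraph r s) ⊑ G := by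
  choose E hED hE hcard using hcard
  obtain ⟨D', h1, h2, h3⟩ := exists_complete_classes (G := G) _ hcard fun i j hij u hu =>
    (Finset.card_le_card (Finset.filter_subset_filter _ (hED j))).trans (hD i j hij u (hED i hu))
  exact join_equipartite_isContained f D' (fun j => (h2 j).ge) h3 fun j d hd => hE j d (h1 j hd)

/-- If each element of `S` misses at most `l` elements of `D`, then all but `S.card * l` elements of
`D` are adjacent to all of `S`. -/
lemma exists_common_subset (S D : Finset V) (l : ℕ)
    (h : ∀ u ∈ S, (D.filter fun v => ¬ G.Adj u v).card ≤ l) :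
    ∃ D' ⊆ D, (∀ v ∈ D', ∀ u ∈ S, G.Adj u v) ∧ D.card ≤ D'.card + S.card * l := by
  refine ⟨D \ S.biUnion fun u => D.filter fun v => ¬ G.Adj u v, Finset.sdiff_subset, ?_, ?_⟩
  · intro v hv u hu
    by_contra huv
    rw [Finset.mem_sdiff] at hv
    exact hv.2 (Finset.mem_biUnion.2 ⟨u, hu, Finset.mem_filter.2 ⟨hv.1, huv⟩⟩)
  · have h1 := Finset.card_biUnion_le_card_mul _ _ _ h
    have h2 := Finset.le_card_sdiff (S.biUnion fun u => D.filter fun v => ¬ G.Adj u v) D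
    omega

end Join

/-! ### Matchings -/

section Matching

variable {V : Type*} {G : SimpleGraph V}

/-- A copy of a matching. -/
lemma exists_copy_matching {k : ℕ} {a b : Fin k → V} (hab : ∀ i, G.Adj (a i) (b i))
    (ha : Function.Injective a) (hb : Function.Injective b) (hne : ∀ i j, a i ≠ b j) :
    ∃ f : Copy (starForest k 1) G, ∀ x, (∃ i, f x = a i) ∨ ∃ i, f x = b i := by
  refine ⟨⟨⟨fun x => x.2.elim (a x.1) fun _ => b x.1, ?_⟩, ?_⟩, ?_⟩
  · rintro ⟨i, _ | x⟩ ⟨j, _ | y⟩ ⟨h, h'⟩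
    · simp at h'
    · obtain rfl : i = j := h
      exact hab i
    · obtain rfl : i = j := h
      exact (hab i).symm
    · simp at h'
  · rintro ⟨i, _ | x⟩ ⟨j, _ | y⟩ h
    · simpa using ha h
    · exact absurd h (hne i j)
    · exact absurd h.symm (hne j i)
    · simpa [Subsingleton.elim x y] using hb h
  · rintro ⟨i, _ | x⟩
    exacts [.inl ⟨i, rfl⟩, .inr ⟨i, rfl⟩]

/-- A set of vertices either contains `k` disjoint edges or becomes independent after the removal
of at most `2 k` vertices. -/
lemma exists_matching_or_cover (G : SimpleGraph V) (Y : Finset V) (k : ℕ) :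
    (∃ f : Copy (starForest k 1) G, ∀ a, f a ∈ Y) ∨
      ∃ C ⊆ Y, C.card ≤ 2 * k ∧ ∀ u ∈ Y \ C, ∀ v ∈ Y \ C, ¬ G.Adj u v := by
  have key : ∀ k, (∃ a b : Fin k → V, (∀ i, a i ∈ Y) ∧ (∀ i, b i ∈ Y) ∧
      (∀ i, G.Adj (a i) (b i)) ∧ Function.Injective a ∧ Function.Injective b ∧
      ∀ i j, a i ≠ b j) ∨
      ∃ C ⊆ Y, C.card ≤ 2 * k ∧ ∀ u ∈ Y \ C, ∀ v ∈ Y \ C, ¬ G.Adj u v := by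
    intro k
    induction k with
    | zero => exact .inl ⟨Fin.elim0, Fin.elim0, fun i => i.elim0, fun i => i.elim0,
        fun i => i.elim0, fun i => i.elim0, fun i => i.elim0, fun i => i.elim0⟩
    | succ k ih =>
      rcases ih with ⟨a, b, ha, hb, hab, ia, ib, hne⟩ | ⟨C, hCY, hC, h⟩
      · let C : Finset V := Finset.univ.image a ∪ Finset.univ.image b
        by_cases h : ∀ u ∈ Y \ C, ∀ v ∈ Y \ C, ¬ G.Adj u v
        · refine .inr ⟨C, ?_, ?_, h⟩
          · intro x hx
            simp only [C, mem_union, mem_image, mem_univ, true_and] at hx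
            rcases hx with ⟨i, rfl⟩ | ⟨i, rfl⟩
            exacts [ha i, hb i]
          · have h1 := Finset.card_union_le (Finset.univ.image a) (Finset.univ.image b)
            have h2 := Finset.card_image_le (s := Finset.univ) (f := a)
            have h3 := Finset.card_image_le (s := Finset.univ) (f := b)
            simp only [card_univ, Fintype.card_fin] at h2 h3
            simp only [C]
            omega
        · push Not at h
          obtain ⟨u, hu, v, hv, huv⟩ := h
          simp only [C, mem_sdiff, mem_union, mem_image, mem_univ, true_and, not_or,
            not_exists] at hu hv
          refine .inl ⟨Fin.cons u a, Fin.cons v b, ?_, ?_, ?_, ?_, ?_, ?_⟩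
          · exact Fin.cases hu.1 ha
          · exact Fin.cases hv.1 hb
          · exact Fin.cases huv hab
          · exact Fin.cons_injective_iff.2 ⟨fun ⟨i, hi⟩ => hu.2.1 i hi, ia⟩
          · exact Fin.cons_injective_iff.2 ⟨fun ⟨i, hi⟩ => hv.2.2 i hi, ib⟩
          · refine Fin.cases (Fin.cases huv.ne fun j => ?_) fun i => Fin.cases ?_ fun j => ?_
            · simpa using fun h => hu.2.2 j h.symm
            · simpa using hv.2.1 i
            · simpa using hne i j
      · exact .inr ⟨C, hCY, hC.trans (by omega), h⟩
  rcases key k with ⟨a, b, ha, hb, hab, ia, ib, hne⟩ | h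
  · obtain ⟨f, hf⟩ := exists_copy_matching hab ia ib hne
    refine .inl ⟨f, fun x => ?_⟩
    rcases hf x with ⟨i, h⟩ | ⟨i, h⟩
    exacts [h ▸ ha i, h ▸ hb i]
  · exact .inr h

/-- A selection of distinct elements from sufficiently large sets. -/
lemma exists_injective_mem {ι : Type*} [Fintype ι] (A : ι → Finset V)
    (h : ∀ i, Fintype.card ι ≤ (A i).card) : ∃ f : ι → V, Function.Injective f ∧ ∀ i, f i ∈ A i := by
  refine (Finset.all_card_le_biUnion_card_iff_exists_injective A).1 fun S => ?_
  rcases S.eq_empty_or_nonempty with rfl | ⟨i, hi⟩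
  · simp
  · exact (Finset.card_le_univ S).trans ((h i).trans (Finset.card_le_card
      (Finset.subset_biUnion_of_mem A hi)))

/-- A copy of a star forest with an additional disjoint edge. -/
lemma exists_copy_starForest_sum {r s : ℕ} (x : Fin r → V) (hx : Function.Injective x) {y z : V}
    (hyz : G.Adj y z) (hxy : ∀ i, x i ≠ y) (hxz : ∀ i, x i ≠ z) (A : Finset V)
    (hA : ∀ i, r * s + r + 2 ≤ (A.filter fun v => G.Adj (x i) v).card) :
    ∃ f : Copy (starForest r s ⊕g (⊤ : SimpleGraph (Fin 2))) G, ∃ B ⊆ A, B.card ≤ r * s ∧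
      ∀ a, (∃ i, f a = x i) ∨ f a = y ∨ f a = z ∨ f a ∈ B := by
  let N : Finset V := Finset.univ.image x ∪ {y, z}
  have hN : N.card ≤ r + 2 := by
    refine (Finset.card_union_le _ _).trans (Nat.add_le_add ?_ Finset.card_le_two)
    simpa using Finset.card_image_le (s := Finset.univ) (f := x)
  obtain ⟨l, hl, hlA⟩ := exists_injective_mem (ι := Fin r × Fin s)
    (fun i => (A.filter fun v => G.Adj (x i.1) v) \ N) fun i => by
      have := Finset.le_card_sdiff N (A.filter fun v => G.Adj (x i.1) v)
      have := hA i.1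
      simp only [Fintype.card_prod, Fintype.card_fin]
      omega
  simp only [mem_sdiff, mem_filter, N, mem_union, mem_image, mem_univ, true_and, mem_insert,
    mem_singleton, not_or, not_exists] at hlA
  let g : (Fin r × Option (Fin s)) ⊕ Fin 2 → V :=
    Sum.elim (fun a => a.2.elim (x a.1) fun j => l (a.1, j)) ![y, z]
  refine ⟨⟨⟨g, ?_⟩, ?_⟩, Finset.univ.image l, ?_, ?_, ?_⟩
  · rintro (⟨i, _ | a⟩ | i) (⟨j, _ | b⟩ | j) h
    · simp [starForest] at h
    · obtain rfl : i = j := (sum_adj_inl.1 h).1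
      exact (hlA (i, b)).1.2
    · simp at h
    · obtain rfl : i = j := (sum_adj_inl.1 h).1
      exact (hlA (i, a)).1.2.symm
    · simp [starForest] at h
    · simp at h
    · simp at h
    · simp at h
    · fin_cases i <;> fin_cases j <;> simp [g] at h ⊢
      exacts [hyz, hyz.symm]
  · rintro (⟨i, _ | a⟩ | i) (⟨j, _ | b⟩ | j) h
    · simpa [g] using hx h
    · exact absurd h ((hlA (j, b)).2.1 i)
    · fin_cases j <;> simp [g] at h
      exacts [absurd h (hxy i), absurd h (hxz i)]
    · exact absurd h.symm ((hlA (i, a)).2.1 j)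
    · simpa [g] using hl h
    · fin_cases j <;> simp [g] at h
      exacts [absurd h (hlA _).2.2.1, absurd h (hlA _).2.2.2]
    · fin_cases i <;> simp [g] at h
      exacts [absurd h.symm (hxy j), absurd h.symm (hxz j)]
    · fin_cases i <;> simp [g] at h
      exacts [absurd h.symm (hlA _).2.2.1, absurd h.symm (hlA _).2.2.2]
    · fin_cases i <;> fin_cases j <;> simp [g] at h ⊢
      exacts [hyz.ne h, hyz.ne' h]
  · intro v hv
    obtain ⟨i, -, rfl⟩ := Finset.mem_image.1 hv
    exact (hlA i).1.1
  · simpa using Finset.card_image_le (s := Finset.univ) (f := l)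
  · rintro (⟨i, _ | a⟩ | i)
    · exact .inl ⟨i, rfl⟩
    · exact .inr (.inr (.inr (Finset.mem_image_of_mem l (Finset.mem_univ (i, a)))))
    · fin_cases i
      · exact .inr (.inl rfl)
      · exact .inr (.inr (.inl rfl))

end Matching

end

section

/-! ### Almost complete multipartite structures -/

variable {V : Type*} {G : SimpleGraph V}

/-- Disjoint independent sets of almost equal size that cover almost all vertices and that are
almost completely joined. -/
structure NearPartition [Fintype V] (G : SimpleGraph V) (p δ : ℕ) (P : Fin p → Finset V) : Prop where
  indep : ∀ i, ∀ u ∈ P i, ∀ v ∈ P i, ¬ G.Adj u v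
  disj : ∀ i j, i ≠ j → Disjoint (P i) (P j)
  miss : ∀ i j, i ≠ j → ∀ u ∈ P i, ((P j).filter fun v => ¬ G.Adj u v).card ≤ δ
  size : ∀ i, Fintype.card V ≤ p * (P i).card + p * δ

variable {m r s k δ : ℕ} {P : Fin (m + 1) → Finset V}

/-- The leaves are taken in class `i₀`, the multipartite part in the other `m` classes. The `r * s`
leaves exclude at most `r * s * δ` vertices of each other class; the term `r + 2` keeps the leaves
away from the centres and from `y`, `z`. -/
lemma NearPartition.star_isContained [Fintype V] (hP : NearPartition G (m + 1) δ P) {X : Finset V}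
    (hX : X.card = r) {y z : V} (hyz : G.Adj y z) (hy : y ∉ X) (hz : z ∉ X) (i₀ : Fin (m + 1))
    (hleaf : ∀ x ∈ X, r * s + r + 2 ≤ ((P i₀).filter fun v => G.Adj x v).card)
    (hcommon : ∀ j, j ≠ i₀ → m * (s * δ) + s + r * s * δ ≤
      ((P j).filter fun d => (∀ x ∈ X, G.Adj x d) ∧ G.Adj y d ∧ G.Adj z d).card) :
    join (starForest r s ⊕g (⊤ : SimpleGraph (Fin 2))) (completeEquipartiteGraph m s) ⊑ G := by
  let x : Fin r → V := fun i => (X.equivFinOfCardEq hX).symm i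
  have hxX : ∀ i, x i ∈ X := fun i => Subtype.prop _
  have hx : Function.Injective x := fun a b hab => by simpa using Subtype.ext hab
  obtain ⟨f, B, hBP, hB, hf⟩ := exists_copy_starForest_sum x hx hyz
    (fun i h => hy (h ▸ hxX i)) (fun i h => hz (h ▸ hxX i)) (P i₀) fun i => hleaf _ (hxX i)
  refine join_equipartite_isContained_of_near (δ := δ) f (fun j => P (i₀.succAbove j)) ?_ ?_
  · intro j
    obtain ⟨D', hD', hBD, h1⟩ := exists_common_subset (G := G) B ((P (i₀.succAbove j)).filter fun d =>
      (∀ x ∈ X, G.Adj x d) ∧ G.Adj y d ∧ G.Adj z d) δ fun u hu =>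
        (Finset.card_le_card (Finset.filter_subset_filter _ (Finset.filter_subset _ _))).trans
          (hP.miss _ _ (Fin.succAbove_ne i₀ j).symm u (hBP hu))
    have h2 := hcommon _ (Fin.succAbove_ne i₀ j)
    have h3 : B.card * δ ≤ r * s * δ := Nat.mul_le_mul_right _ hB
    refine ⟨D', hD'.trans (Finset.filter_subset _ _), fun d hd w => ?_, by omega⟩
    have hd' := Finset.mem_filter.1 (hD' hd)
    rcases hf w with ⟨i, h⟩ | h | h | h
    · exact h ▸ hd'.2.1 _ (hxX i)
    · exact h ▸ hd'.2.2.1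
    · exact h ▸ hd'.2.2.2
    · exact hBD d hd _ h
  · intro i j hij u hu
    exact hP.miss _ _ (by simpa using hij) u hu

/-- One of the `r + 1` vertices, with a neighbour `z` in class `i₀`, supplies the extra edge; the
others are the centres. The additional `δ` pays for the vertices not adjacent to `z`. -/
lemma NearPartition.star_isContained_of_common [Fintype V] (hP : NearPartition G (m + 1) δ P) {Q : Finset V}
    (hQ : Q.card = r + 1) (i₀ : Fin (m + 1))
    (hleaf : ∀ x ∈ Q, r * s + r + 2 ≤ ((P i₀).filter fun v => G.Adj x v).card)
    (hcommon : ∀ j, j ≠ i₀ → m * (s * δ) + s + r * s * δ + δ ≤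
      ((P j).filter fun d => ∀ x ∈ Q, G.Adj x d).card) :
    join (starForest r s ⊕g (⊤ : SimpleGraph (Fin 2))) (completeEquipartiteGraph m s) ⊑ G := by
  obtain ⟨y, hy⟩ : Q.Nonempty := by rw [← Finset.card_pos]; omega
  have hX : (Q.erase y).card = r := by rw [Finset.card_erase_of_mem hy]; omega
  obtain ⟨z, hz, hzX⟩ : ∃ z ∈ (P i₀).filter fun v => G.Adj y v, z ∉ Q.erase y := by
    by_contra! h
    have h1 := Finset.card_le_card (s := (P i₀).filter fun v => G.Adj y v) (t := Q.erase y) h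
    have := hleaf y hy
    omega
  rw [Finset.mem_filter] at hz
  refine hP.star_isContained hX hz.2 (by simp) hzX i₀
    (fun x hx => hleaf x (Finset.mem_of_mem_erase hx)) fun j hj => ?_
  obtain ⟨D', hD', hzD, h1⟩ := exists_common_subset (G := G) {z} ((P j).filter fun d => ∀ x ∈ Q, G.Adj x d) δ
    fun u hu => (Finset.card_le_card (Finset.filter_subset_filter _
      (Finset.filter_subset _ _))).trans
        (hP.miss i₀ j hj.symm u (by rw [Finset.mem_singleton.1 hu]; exact hz.1))
  have h2 := hcommon j hj
  rw [Finset.card_singleton, one_mul] at h1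
  refine le_trans (b := D'.card) (by omega) (Finset.card_le_card fun d hd => ?_)
  have hd' := Finset.mem_filter.1 (hD' hd)
  exact Finset.mem_filter.2 ⟨hd'.1, fun x hx => hd'.2 x (Finset.mem_of_mem_erase hx), hd'.2 y hy,
    hzD d hd z (Finset.mem_singleton_self z)⟩

/-- If the vertices of `Y` are joined to almost all of `D j` for all `j`, then `Y` is almost
independent, unless a matching in `Y` extends. -/
lemma exists_cover_of_near {D : Fin m → Finset V} {l : ℕ}
    (hfree : (join (starForest k 1) (completeEquipartiteGraph m s)).Free G)
    (hD : ∀ i j, i ≠ j → ∀ u ∈ D i, ((D j).filter fun v => ¬ G.Adj u v).card ≤ δ)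
    {Y : Finset V} (hY : ∀ j, ∀ y ∈ Y, ((D j).filter fun v => ¬ G.Adj y v).card ≤ l)
    (hcard : ∀ j, m * (s * δ) + s + 2 * k * l ≤ (D j).card) :
    ∃ C ⊆ Y, C.card ≤ 2 * k ∧ ∀ u ∈ Y \ C, ∀ v ∈ Y \ C, ¬ G.Adj u v := by
  refine (exists_matching_or_cover G Y k).resolve_left fun ⟨f, hf⟩ => hfree ?_
  refine join_equipartite_isContained_of_near (δ := δ) f D (fun j => ?_) hD
  obtain ⟨D', hD', hfD, h1⟩ := exists_common_subset (G := G) (Finset.univ.image f) (D j) l fun u hu => by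
    obtain ⟨a, -, rfl⟩ := Finset.mem_image.1 hu
    exact hY j _ (hf a)
  have h2 : (Finset.univ.image f).card * l ≤ 2 * k * l := by
    refine Nat.mul_le_mul_right _ (Finset.card_image_le.trans ?_)
    simp [mul_comm]
  have h3 := hcard j
  exact ⟨D', hD', fun d hd w => hfD d hd _ (Finset.mem_image_of_mem f (mem_univ w)), by omega⟩

/-- Pigeonhole: a set of vertices with large degrees into `D` has a large subset with a large
common neighbourhood in `D`. -/
lemma exists_subset_common [Fintype V] {W D : Finset V} {h a g : ℕ} (ha : 0 < a) (hg : 0 < g)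
    (hW : W.Nonempty) (hdeg : ∀ x ∈ W, h ≤ (D.filter fun z => G.Adj x z).card)
    (hD : D.card ≤ a * h) (hgh : g * 2 ^ (W.card + 1) ≤ h) :
    ∃ Q ⊆ W, W.card ≤ 2 * a * Q.card ∧ g ≤ (D.filter fun z => ∀ x ∈ Q, G.Adj x z).card := by
  let c : V → Finset V := fun z => W.filter fun x => G.Adj x z
  -- As `|D| ≤ a * h`, a vertex of `D` sees on average at least `|W| / a` vertices of `W`; `H`
  -- collects those seeing at least half as many. Double counting gives `|H| ≥ h / 2`.
  let H : Finset V := D.filter fun z => W.card ≤ 2 * a * (c z).card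
  have hsum : W.card * h ≤ ∑ z ∈ D, (c z).card := by
    calc W.card * h = ∑ x ∈ W, h := by simp
      _ ≤ ∑ x ∈ W, (D.filter fun z => G.Adj x z).card := Finset.sum_le_sum hdeg
      _ = ∑ z ∈ D, (c z).card := by
        simp only [c, Finset.card_filter]
        exact Finset.sum_comm
  have hle : ∀ z ∈ D, 2 * a * (c z).card ≤
      W.card + if W.card ≤ 2 * a * (c z).card then 2 * a * W.card else 0 := by
    intro z _
    split_ifs with hz
    · exact le_add_left (Nat.mul_le_mul_left _ (Finset.card_le_card (Finset.filter_subset _ _)))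
    · omega
  have h1 := Finset.sum_le_sum hle
  rw [← Finset.mul_sum, Finset.sum_add_distrib, ← Finset.sum_filter] at h1
  simp only [sum_const, smul_eq_mul] at h1
  have hWpos : 0 < W.card := Finset.card_pos.2 hW
  have hH : h ≤ 2 * H.card := by
    have h2 : 2 * a * (W.card * h) ≤ a * h * W.card + H.card * (2 * a * W.card) :=
      (Nat.mul_le_mul_left _ hsum).trans (h1.trans (Nat.add_le_add_right
        (Nat.mul_le_mul_right _ hD) _))
    have h3 : (a * W.card) * (2 * h) ≤ (a * W.card) * (h + 2 * H.card) := by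
      calc _ = 2 * a * (W.card * h) := by ring
        _ ≤ _ := h2
        _ = _ := by ring
    have := Nat.le_of_mul_le_mul_left h3 (Nat.mul_pos ha hWpos)
    omega
  -- Pigeonhole over the traces on `W`. The `+ 1` in the exponent of `hgh` pays for the half lost in
  -- passing from `h` to `|H|`.
  obtain ⟨Q, hQ, hcard⟩ := Finset.exists_le_card_fiber_of_mul_le_card_of_maps_to
    (s := H) (t := W.powerset) (f := c) (n := g)
    (fun z _ => Finset.mem_powerset.2 (Finset.filter_subset _ _))
    ⟨∅, Finset.empty_mem_powerset _⟩ (by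
      rw [Finset.card_powerset]
      rw [pow_succ] at hgh
      have : g * (2 ^ W.card * 2) = 2 * (2 ^ W.card * g) := by ring
      omega)
  obtain ⟨z, hz⟩ := Finset.card_pos.1 (hg.trans_le hcard)
  rw [Finset.mem_filter] at hz
  refine ⟨Q, Finset.mem_powerset.1 hQ, ?_, hcard.trans (Finset.card_le_card fun u hu => ?_)⟩
  · rw [← hz.2]
    exact (Finset.mem_filter.1 hz.1).2
  · rw [Finset.mem_filter] at hu ⊢
    refine ⟨(Finset.mem_filter.1 hu.1).1, fun x hx => ?_⟩
    rw [← hu.2] at hx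
    exact (Finset.mem_filter.1 hx).2

/-- The number of vertices with large degree into every class is bounded. -/
lemma NearPartition.card_exceptional_lt [Fintype V] (hP : NearPartition G (m + 1) δ P) {h a g : ℕ}
    (hfree : (join (starForest r s ⊕g (⊤ : SimpleGraph (Fin 2)))
      (completeEquipartiteGraph m s)).Free G)
    (ha : 0 < a) (hg : 0 < g) {W : Finset V}
    (hW : ∀ x ∈ W, ∀ i, h ≤ ((P i).filter fun z => G.Adj x z).card)
    (hsize : ∀ i, (P i).card ≤ a * h)
    (hgh : g * 2 ^ ((r + 1) * (2 * a) ^ (m + 1) + 1) ≤ h)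
    (hleaf : r * s + r + 2 ≤ h) (hcommon : m * (s * δ) + s + r * s * δ + δ ≤ g) :
    W.card < (r + 1) * (2 * a) ^ (m + 1) := by
  by_contra! hlt
  -- Each class costs a factor `2 * a`, so `r + 1` vertices survive all `m + 1` classes.
  have key : ∀ S : Finset (Fin (m + 1)), ∃ Q ⊆ W,
      Q.card = (r + 1) * (2 * a) ^ (m + 1 - S.card) ∧
      ∀ i ∈ S, g ≤ ((P i).filter fun z => ∀ x ∈ Q, G.Adj x z).card := by
    intro S
    induction S using Finset.induction_on with
    | empty =>
      obtain ⟨Q, hQ, hc⟩ := Finset.exists_subset_card_eq hlt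
      exact ⟨Q, hQ, by simpa using hc, by simp⟩
    | insert i S hi ih =>
      obtain ⟨Q, hQW, hQ, hS⟩ := ih
      have hcard : S.card + 1 ≤ m + 1 := by
        rw [← Finset.card_insert_of_notMem hi]
        exact (Finset.card_le_univ _).trans (by simp)
      obtain ⟨Q', hQ', h1, h2⟩ := exists_subset_common (D := P i) ha hg (W := Q) (h := h)
        (by rw [← Finset.card_pos, hQ]; positivity) (fun x hx => hW x (hQW hx) i) (hsize i)
        (le_trans (Nat.mul_le_mul_left _ (Nat.pow_le_pow_right (by omega) (by
          rw [hQ]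
          gcongr
          · omega
          · omega))) hgh)
      have h3 : (r + 1) * (2 * a) ^ (m + 1 - (insert i S).card) ≤ Q'.card := by
        rw [hQ, Finset.card_insert_of_notMem hi] at *
        rw [show m + 1 - S.card = (m + 1 - (S.card + 1)) + 1 by omega, pow_succ,
          ← mul_assoc, mul_comm _ (2 * a)] at h1
        exact Nat.le_of_mul_le_mul_left h1 (by positivity)
      obtain ⟨Q'', hQ'', hc⟩ := Finset.exists_subset_card_eq h3
      refine ⟨Q'', hQ''.trans (hQ'.trans hQW), hc, fun j hj => ?_⟩
      rcases Finset.mem_insert.1 hj with rfl | hj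
      · exact h2.trans (Finset.card_le_card (Finset.monotone_filter_right _
          fun z _ hz x hx => hz x (hQ'' hx)))
      · exact (hS j hj).trans (Finset.card_le_card (Finset.monotone_filter_right _
          fun z _ hz x hx => hz x (hQ' (hQ'' hx))))
  obtain ⟨Q, hQW, hQ, hS⟩ := key Finset.univ
  exact hfree (hP.star_isContained_of_common (Q := Q) (by simpa using hQ) 0
    (fun x hx => hleaf.trans (hW x (hQW hx) 0)) fun j _ => hcommon.trans (hS j (mem_univ j)))

/-- If the sets `A i` have large total size but any `m` of them meet in at most `r` points, then
all of them are equal to the ground set, which has `r` elements. -/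
lemma eq_of_sum_card_of_card_inter {W : Finset V} {A : Fin (m + 1) → Finset V}
    (hAW : ∀ i, A i ⊆ W) (hsum : m * W.card + r ≤ ∑ i, (A i).card)
    (hinter : ∀ i₀, (W.filter fun x => ∀ i, i ≠ i₀ → x ∈ A i).card ≤ r) :
    W.card = r ∧ ∀ i, A i = W := by
  have hB : ∀ i, (W \ A i).card + (A i).card = W.card := fun i =>
    Finset.card_sdiff_add_card_eq_card (hAW i)
  have hBsum : ∑ i, (W \ A i).card + ∑ i, (A i).card = (m + 1) * W.card := by
    rw [← Finset.sum_add_distrib, Finset.sum_congr rfl fun i _ => hB i]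
    simp
  -- The complements `W \ A i` have total size at most `|W| - r`, and those with `i ≠ i₀` already
  -- cover all but `r` points of `W`. Nothing is left for `i₀`.
  have hempty : ∀ i, (W \ A i).card = 0 := by
    intro i₀
    have h1 : W ⊆ (W.filter fun x => ∀ i, i ≠ i₀ → x ∈ A i) ∪
        (Finset.univ.erase i₀).biUnion fun i => W \ A i := by
      intro x hx
      by_cases h : ∀ i, i ≠ i₀ → x ∈ A i
      · exact Finset.mem_union_left _ (Finset.mem_filter.2 ⟨hx, h⟩)
      · push Not at h
        obtain ⟨i, hi, hxi⟩ := h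
        exact Finset.mem_union_right _ (Finset.mem_biUnion.2
          ⟨i, Finset.mem_erase.2 ⟨hi, mem_univ _⟩, Finset.mem_sdiff.2 ⟨hx, hxi⟩⟩)
    have h2 := (Finset.card_le_card h1).trans (Finset.card_union_le _ _)
    have h3 : ((Finset.univ.erase i₀).biUnion fun i => W \ A i).card ≤
        ∑ i ∈ Finset.univ.erase i₀, (W \ A i).card := Finset.card_biUnion_le
    have h4 := Finset.add_sum_erase Finset.univ (fun i => (W \ A i).card) (mem_univ i₀)
    have h5 := hinter i₀
    rw [add_mul, one_mul] at hBsum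
    omega
  have hA : ∀ i, A i = W := fun i =>
    (hAW i).antisymm (Finset.sdiff_eq_empty_iff_subset.1 (Finset.card_eq_zero.1 (hempty i)))
  refine ⟨?_, hA⟩
  have h1 := hinter 0
  simp only [hA] at h1 hsum
  rw [Finset.filter_true_of_mem fun x hx _ _ => hx] at h1
  simp only [sum_const, card_univ, Fintype.card_fin, smul_eq_mul, add_mul, one_mul] at hsum
  omega

end

/-! ### Consequences of the two degree conditions for a near partition -/

section

variable {V : Type*} [Fintype V] {G : SimpleGraph V}
variable {m r s k δ : ℕ} {P : Fin (m + 1) → Finset V}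

lemma NearPartition.mul_card_le (hP : NearPartition G (m + 1) δ P)
    (hdeg : ∀ v, (m + 1) * Fintype.card V ≤
      (m + 1) * (Finset.univ.filter fun u => G.Adj v u).card + Fintype.card V + (m + 1))
    (i : Fin (m + 1)) : (m + 1) * (P i).card ≤ Fintype.card V + (m + 1) := by
  rcases (P i).eq_empty_or_nonempty with h | ⟨v, hv⟩
  · simp [h]
  · have h1 : P i ⊆ Finset.univ.filter fun u => ¬ G.Adj v u := fun u hu => by
      simpa using hP.indep i v hv u hu
    have h2 := Finset.card_le_card h1
    have h3 := Finset.card_filter_add_card_filter_not (s := (Finset.univ : Finset V)) (G.Adj v ·)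
    rw [Finset.card_univ] at h3
    have h4 := hdeg v
    have h5 := Nat.mul_le_mul_left (m + 1) h2
    have h6 := congrArg ((m + 1) * ·) h3
    simp only [mul_add (m + 1)] at h6
    omega

/-- The degree condition allows a vertex only about `n / (m + 1)` non-neighbours, roughly one class.
The misses in `P i` use up this allowance. -/
lemma NearPartition.card_miss_le (hP : NearPartition G (m + 1) δ P)
    (hdeg : ∀ v, (m + 1) * Fintype.card V ≤
      (m + 1) * (Finset.univ.filter fun u => G.Adj v u).card + Fintype.card V + (m + 1))
    {x : V} {h : ℕ} {i j : Fin (m + 1)} (hij : j ≠ i)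
    (hx : ((P i).filter fun v => G.Adj x v).card < h) :
    ((P j).filter fun v => ¬ G.Adj x v).card ≤ h + δ := by
  have h1 : ((P i).filter fun v => ¬ G.Adj x v) ∪ ((P j).filter fun v => ¬ G.Adj x v) ⊆
      Finset.univ.filter fun u => ¬ G.Adj x u := fun u hu => by
    simp only [mem_union, mem_filter] at hu
    simp only [mem_filter, mem_univ, true_and]
    tauto
  have h2 := Finset.card_le_card h1
  rw [Finset.card_union_of_disjoint (Finset.disjoint_filter_filter (hP.disj i j hij.symm))] at h2
  have h3 := Finset.card_filter_add_card_filter_not (s := (Finset.univ : Finset V)) (G.Adj x ·)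
  rw [Finset.card_univ] at h3
  have h4 := hdeg x
  have h5 := Finset.card_filter_add_card_filter_not (s := P i) (G.Adj x ·)
  have h6 := hP.size i
  set a := ((P j).filter fun v => ¬ G.Adj x v).card
  set b := ((P i).filter fun v => ¬ G.Adj x v).card
  set c := ((P i).filter fun v => G.Adj x v).card
  set d := (Finset.univ.filter fun u => ¬ G.Adj x u).card
  have h7 := Nat.mul_le_mul_left (m + 1) h2
  have h8 := congrArg ((m + 1) * ·) h3
  have h9 := congrArg ((m + 1) * ·) h5
  simp only [mul_add (m + 1)] at h7 h8 h9
  have h10 : (m + 1) * a ≤ (m + 1) * (c + δ + 1) := by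
    simp only [mul_add (m + 1)]
    omega
  have := Nat.le_of_mul_le_mul_left h10 (by omega)
  omega

/-- The structure of graphs with large minimum degree and large degree sums of cliques that have an
almost complete multipartite structure. -/
theorem NearPartition.exists_structure (hP : NearPartition G (m + 1) δ P)
    (hmatch : (join (starForest k 1) (completeEquipartiteGraph m s)).Free G)
    (hstar : (join (starForest r s ⊕g (⊤ : SimpleGraph (Fin 2)))
      (completeEquipartiteGraph m s)).Free G)
    (hdeg : ∀ v, (m + 1) * Fintype.card V ≤
      (m + 1) * (Finset.univ.filter fun u => G.Adj v u).card + Fintype.card V + (m + 1))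
    (hclique : ∀ z : Fin (m + 1) → V, (∀ i j, i ≠ j → G.Adj (z i) (z j)) →
      m * Fintype.card V + r ≤ ∑ i, (Finset.univ.filter fun u => G.Adj (z i) u).card)
    {h g : ℕ} (h_le : 64 * (m + 1) * (k + 1) * h ≤ Fintype.card V)
    (le_h : Fintype.card V ≤ 128 * (m + 1) * (k + 1) * h)
    (hgh : g * 2 ^ ((r + 1) * (2 * (129 * (k + 1))) ^ (m + 1) + 1) ≤ h)
    (hδg : (m * s + r * s + m + s + r + 2 * k + 4) * (δ + 1) ≤ g) :
    ∃ X : Finset V, X.card = r ∧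
      (∃ c : V → Fin (m + 1), ∀ u v, u ∉ X → v ∉ X → G.Adj u v → c u ≠ c v) ∧
      join (G.induce (X : Set V)) (completeEquipartiteGraph (m + 1) s) ⊑ G := by
  obtain ⟨K, hK⟩ : ∃ K, K = k + 1 := ⟨_, rfl⟩
  rw [← hK] at h_le le_h hgh
  -- numerical consequences of the choice of the constants
  have hexp : (m * s + r * s + m + s + r + 2 * k + 4) * (δ + 1) = m * (s * δ) + r * s * δ +
      m * δ + s * δ + r * δ + 2 * (k * δ) + 4 * δ + m * s + r * s + m + s + r + 2 * k + 4 := by ring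
  rw [hexp] at hδg
  have hg0 : 0 < g := by omega
  have hgh' : g ≤ h := le_trans (Nat.le_mul_of_pos_right _ (by positivity)) hgh
  have hKh : h ≤ K * h := Nat.le_mul_of_pos_left _ (by omega)
  have hkh : K * h = k * h + h := by rw [hK]; ring
  have hk : k ≤ k * h := Nat.le_mul_of_pos_right _ (by omega)
  -- Class sizes lie between `64 * K * h - δ` and `129 * K * h`. The factor `K = k + 1` leaves room
  -- for the losses of order `k * h` below.
  have hPlow : ∀ i, 64 * (K * h) ≤ (P i).card + δ := by
    intro i
    refine Nat.le_of_mul_le_mul_left (?_ : (m + 1) * _ ≤ (m + 1) * _) (by omega)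
    calc (m + 1) * (64 * (K * h)) = 64 * (m + 1) * K * h := by ring
      _ ≤ _ := h_le
      _ ≤ _ := hP.size i
      _ = _ := by ring
  have hPup : ∀ i, (P i).card ≤ 129 * K * h := by
    intro i
    have : (P i).card ≤ 128 * (K * h) + 1 := by
      refine Nat.le_of_mul_le_mul_left (?_ : (m + 1) * _ ≤ (m + 1) * _) (by omega)
      calc _ ≤ _ := hP.mul_card_le hdeg i
        _ ≤ _ := Nat.add_le_add_right le_h _
        _ = _ := by ring
    have h2 : 129 * K * h = 129 * (K * h) := by ring
    omega
  -- exceptional vertices and the classes of the other ones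
  obtain ⟨W, hW⟩ : ∃ W : Finset V, W = Finset.univ.filter fun x =>
    ∀ i, h ≤ ((P i).filter fun z => G.Adj x z).card := ⟨_, rfl⟩
  have hWmem : ∀ x, x ∈ W ↔ ∀ i, h ≤ ((P i).filter fun z => G.Adj x z).card := by simp [hW]
  have hWcard := hP.card_exceptional_lt (a := 129 * K) hstar (by omega) hg0
    (fun x hx => (hWmem x).1 hx) hPup hgh (by omega) (by omega)
  obtain ⟨Y, hY⟩ : ∃ Y : Fin (m + 1) → Finset V, ∀ i, Y i = Finset.univ.filter fun x =>
    ((P i).filter fun z => G.Adj x z).card < h := ⟨_, fun i => rfl⟩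
  have hYmem : ∀ i x, x ∈ Y i ↔ ((P i).filter fun z => G.Adj x z).card < h := by simp [hY]
  have hYW : ∀ x, x ∉ W → ∃ i, x ∈ Y i := by
    intro x hx
    rw [hWmem] at hx
    push Not at hx
    simpa only [hYmem] using hx
  have hYnot : ∀ i, ∀ x ∈ Y i, x ∉ W := by
    intro i x hx hxW
    have := (hYmem i x).1 hx
    have := (hWmem x).1 hxW i
    omega
  have hmiss : ∀ i j, j ≠ i → ∀ x ∈ Y i, ((P j).filter fun v => ¬ G.Adj x v).card ≤ 2 * h :=
    fun i j hij x hx => (hP.card_miss_le hdeg hij ((hYmem i x).1 hx)).trans (by omega)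
  have hPY : ∀ i, P i ⊆ Y i := by
    intro i x hx
    rw [hYmem, Finset.filter_false_of_mem fun v hv => hP.indep i x hx v hv]
    simp only [card_empty]
    omega
  -- vertices without neighbours in their own class
  have hZ : ∀ i, ∃ Z ⊆ P i, (∀ z ∈ Z, ∀ y ∈ Y i, ¬ G.Adj z y) ∧ 59 * (K * h) ≤ Z.card := by
    intro i
    obtain ⟨C, hCY, hC, hind⟩ := exists_cover_of_near (D := fun j => P (i.succAbove j)) (δ := δ)
      (Y := Y i) (l := 2 * h) hmatch (fun a b hab u hu => hP.miss _ _ (by simpa using hab) u hu)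
      (fun j y hy => hmiss i _ (Fin.succAbove_ne i j) y hy) fun j => by
        have := hPlow (i.succAbove j)
        have h2 : 2 * k * (2 * h) = 4 * (k * h) := by ring
        omega
    -- Besides `C`, its neighbours in `P i` are removed: `C` has at most `2 * k` elements, each in
    -- `Y i` and so with fewer than `h` neighbours there.
    refine ⟨(P i \ C) \ C.biUnion fun c => (P i).filter fun z => G.Adj c z,
      Finset.sdiff_subset.trans Finset.sdiff_subset, fun z hz y hy hzy => ?_, ?_⟩
    · simp only [mem_sdiff, mem_biUnion, mem_filter, not_exists, not_and] at hz
      by_cases hyC : y ∈ C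
      · exact hz.2 y hyC hz.1.1 hzy.symm
      · exact hind z (Finset.mem_sdiff.2 ⟨hPY i hz.1.1, hz.1.2⟩) y
          (Finset.mem_sdiff.2 ⟨hy, hyC⟩) hzy
    · have h1 := Finset.le_card_sdiff (C.biUnion fun c => (P i).filter fun z => G.Adj c z)
        (P i \ C)
      have h2 := Finset.le_card_sdiff C (P i)
      have h3 : (C.biUnion fun c => (P i).filter fun z => G.Adj c z).card ≤ C.card * h :=
        Finset.card_biUnion_le_card_mul _ _ _ fun c hc => ((hYmem i c).1 (hCY hc)).le
      have h4 : C.card * h ≤ 2 * k * h := Nat.mul_le_mul_right _ hC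
      have h5 : 2 * k * h = 2 * (k * h) := by ring
      have h6 := hPlow i
      omega
  choose Z hZP hZY hZcard using hZ
  -- adjacency patterns on the exceptional vertices
  let pat : V → Finset V := fun z => W.filter fun x => G.Adj x z
  have hpatW : ∀ z, pat z ⊆ W := fun z => Finset.filter_subset _ _
  have hpow : 2 ^ W.card * g ≤ h := by
    refine le_trans ?_ hgh
    rw [mul_comm]
    exact Nat.mul_le_mul_left _ (Nat.pow_le_pow_right (by omega) (by omega))
  -- Call a pattern popular in `Z i` if at least `g` vertices of `Z i` have it. For one popular
  -- pattern per class, representatives can be chosen that form a clique, and the clique condition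
  -- applies to them.
  have hpopular : ∀ A : Fin (m + 1) → Finset V,
      (∀ i, g ≤ ((Z i).filter fun z => pat z = A i).card) → W.card = r ∧ ∀ i, A i = W := by
    intro A hA
    have hA' : ∀ i, ∃ z ∈ Z i, pat z = A i := by
      intro i
      obtain ⟨z, hz⟩ := Finset.card_pos.1 (hg0.trans_le (hA i))
      exact ⟨z, Finset.mem_filter.1 hz⟩
    refine eq_of_sum_card_of_card_inter (m := m) ?_ ?_ ?_
    · intro i
      obtain ⟨z, -, hz⟩ := hA' i
      exact hz ▸ hpatW z
    · obtain ⟨D, hD, hD1, hadj⟩ := exists_complete_classes (G := G) (δ := δ) (s := 1)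
        (fun i => (Z i).filter fun z => pat z = A i) (fun i => (by
          refine le_trans ?_ (hA i)
          rw [one_mul, add_mul, one_mul]
          omega)) fun i j hij u hu => (Finset.card_le_card (Finset.filter_subset_filter _
          ((Finset.filter_subset _ _).trans (hZP j)))).trans
            (hP.miss i j hij u (hZP i (Finset.mem_filter.1 hu).1))
      choose z hz using fun i => Finset.card_eq_one.1 (hD1 i)
      have hzD : ∀ i, z i ∈ D i := fun i => by simp [hz i]
      have hzZ : ∀ i, z i ∈ Z i ∧ pat (z i) = A i := fun i => Finset.mem_filter.1 (hD i (hzD i))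
      have h1 := hclique z fun i j hij => hadj i j hij _ (hzD i) _ (hzD j)
      have h2 : ∑ i, (Finset.univ.filter fun u => G.Adj (z i) u).card =
          ∑ u, (Finset.univ.filter fun i => G.Adj (z i) u).card := by
        simp only [Finset.card_filter]
        exact Finset.sum_comm
      have h3 : ∑ i, (A i).card = ∑ u ∈ W, (Finset.univ.filter fun i => G.Adj (z i) u).card := by
        simp only [← (hzZ _).2, pat, Finset.card_filter, G.adj_comm]
        exact Finset.sum_comm
      -- A vertex outside `W` lies in some `Y i` and is not adjacent to `z i`, so it contributes at
      -- most `m` to the degree sum. The excess `r` over `m * n` has to come from `W`.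
      have h4 : ∑ u ∈ Wᶜ, (Finset.univ.filter fun i => G.Adj (z i) u).card ≤ Wᶜ.card * m := by
        refine Finset.sum_le_card_nsmul _ _ _ fun u hu => ?_
        obtain ⟨i, hi⟩ := hYW u (Finset.mem_compl.1 hu)
        have : (Finset.univ.filter fun i => G.Adj (z i) u) ⊆ Finset.univ.erase i := by
          intro j hj
          refine Finset.mem_erase.2 ⟨?_, mem_univ _⟩
          rintro rfl
          exact hZY j _ (hzZ j).1 u hi (Finset.mem_filter.1 hj).2
        simpa using Finset.card_le_card this
      have h5 := Finset.sum_add_sum_compl W fun u =>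
        (Finset.univ.filter fun i => G.Adj (z i) u).card
      have h6 := congrArg (m * ·) (Finset.card_add_card_compl W)
      simp only [mul_add] at h6
      rw [mul_comm] at h4
      omega
    -- Otherwise `r + 1` points of `W` would have `g` common neighbours in every class other than
    -- `i₀`, and, being in `W`, many neighbours in `P i₀`.
    · intro i₀
      by_contra! hlt
      obtain ⟨Q, hQ, hQr⟩ := Finset.exists_subset_card_eq hlt
      refine hstar (hP.star_isContained_of_common (Q := Q) hQr i₀ (fun x hx => ?_) fun j hj => ?_)
      · have := (hWmem x).1 (Finset.mem_filter.1 (hQ hx)).1 i₀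
        omega
      · refine le_trans (b := g) (by omega) ((hA j).trans (Finset.card_le_card fun z hz => ?_))
        rw [Finset.mem_filter] at hz ⊢
        refine ⟨hZP j hz.1, fun x hx => ?_⟩
        have := (Finset.mem_filter.1 (hQ hx)).2 j hj
        rw [← hz.2] at this
        exact (Finset.mem_filter.1 this).2
  -- There are at most `2 ^ W.card` patterns, so among any `h` vertices of `Z i` a popular one
  -- occurs.
  have hexists : ∀ (i) (Z' : Finset V), Z' ⊆ Z i → h ≤ Z'.card → ∃ A, (∃ z ∈ Z', pat z = A) ∧
      g ≤ ((Z i).filter fun z => pat z = A).card := by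
    intro i Z' hZ' hcard
    obtain ⟨A, hA, hgA⟩ := Finset.exists_le_card_fiber_of_mul_le_card_of_maps_to
      (s := Z') (t := W.powerset) (f := pat) (n := g)
      (fun z _ => Finset.mem_powerset.2 (hpatW z))
      ⟨∅, Finset.empty_mem_powerset _⟩ (by rw [Finset.card_powerset]; exact hpow.trans hcard)
    obtain ⟨z, hz⟩ := Finset.card_pos.1 (hg0.trans_le hgA)
    exact ⟨A, ⟨z, Finset.mem_filter.1 hz⟩,
      hgA.trans (Finset.card_le_card (Finset.filter_subset_filter _ hZ'))⟩
  choose A hAz hA using fun i => hexists i (Z i) (Finset.Subset.refl _)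
    (le_trans (by omega) (hZcard i))
  have hWr : W.card = r := (hpopular A hA).1
  have hZ' : ∀ i, 58 * (K * h) ≤ ((Z i).filter fun z => pat z = W).card := by
    intro i
    have h1 := Finset.card_filter_add_card_filter_not (s := Z i) (fun z => pat z = W)
    have h2 : ((Z i).filter fun z => ¬ pat z = W).card < h := by
      -- Otherwise a pattern other than `W` is popular, and putting it in place of `A i` contradicts
      -- `hpopular`.
      by_contra! hle
      obtain ⟨A', ⟨z, hz, hzA⟩, hA'⟩ := hexists i _ (Finset.filter_subset _ _) hle
      have h3 := (hpopular (Function.update A i A') fun j => by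
        by_cases hj : j = i
        · subst hj
          simpa using hA'
        · simpa [hj] using hA j).2 i
      rw [Function.update_self] at h3
      exact (Finset.mem_filter.1 hz).2 (hzA.trans h3)
    have := hZcard i
    omega
  have hpat : ∀ {z}, pat z = W → ∀ x ∈ W, G.Adj x z := by
    intro z hz x hx
    rw [← hz] at hx
    exact (Finset.mem_filter.1 hx).2
  refine ⟨W, hWr, ?_, ?_⟩
  · have hc : ∀ x, ∃ i, x ∉ W → x ∈ Y i := by
      intro x
      by_cases hx : x ∈ W
      · exact ⟨0, fun h => absurd hx h⟩
      · obtain ⟨i, hi⟩ := hYW x hx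
        exact ⟨i, fun _ => hi⟩
    choose c hc using hc
    -- An edge inside one class would be the extra edge next to stars centred at `W`. In each other
    -- class, `u` and `v` together miss at most `4 * h` of the at least `58 * K * h` vertices joined
    -- to all of `W`.
    refine ⟨c, fun u v hu hv huv hcuv => hstar ?_⟩
    have hu' := hc u hu
    have hv' := hc v hv
    rw [← hcuv] at hv'
    refine hP.star_isContained hWr huv hu hv (c u)
      (fun x hx => le_trans (by omega) ((hWmem x).1 hx (c u))) fun j hj => ?_
    obtain ⟨D, hD, hDadj, hDcard⟩ := exists_common_subset (G := G) {u, v}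
      ((Z j).filter fun z => pat z = W) (2 * h) (by
        intro x hx
        have hxY : x ∈ Y (c u) := by
          simp only [mem_insert, mem_singleton] at hx
          rcases hx with rfl | rfl <;> assumption
        exact (Finset.card_le_card (Finset.filter_subset_filter _
          ((Finset.filter_subset _ _).trans (hZP j)))).trans (hmiss _ j hj x hxY))
    have h1 : ({u, v} : Finset V).card * (2 * h) ≤ 2 * (2 * h) :=
      Nat.mul_le_mul_right _ Finset.card_le_two
    have h2 := hZ' j
    refine le_trans (b := D.card) (by omega) (Finset.card_le_card fun d hd => ?_)
    have hd' := Finset.mem_filter.1 (hD hd)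
    exact Finset.mem_filter.2 ⟨hZP j hd'.1, hpat hd'.2, hDadj d hd u (by simp),
      hDadj d hd v (by simp)⟩
  · refine join_equipartite_isContained_of_near (δ := δ) (Copy.induce G (W : Set V))
      (fun i => (Z i).filter fun z => pat z = W) (fun j => ⟨_, Finset.Subset.refl _, ?_, ?_⟩) ?_
    · intro d hd w
      exact hpat (Finset.mem_filter.1 hd).2 _ w.2
    · have := hZ' j
      rw [add_mul, one_mul]
      omega
    · intro i j hij u hu
      exact (Finset.card_le_card (Finset.filter_subset_filter _
          ((Finset.filter_subset _ _).trans (hZP j)))).trans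
            (hP.miss i j hij u (hZP i (Finset.mem_filter.1 hu).1))

end

section

/-! ### From the minimum degree to an almost complete multipartite structure -/

variable {V : Type*} {G : SimpleGraph V} {m s k : ℕ}

/-- The number of vertices with many neighbours in all classes of a complete multipartite subgraph
is bounded. -/
lemma card_exceptional_le
    (hfree : (join (starForest k 1) (completeEquipartiteGraph m s)).Free G)
    {t : ℕ} {K : Fin (m + 1) → Finset V} (hK : ∀ i, (K i).card = t)
    (hKK : ∀ i j, i ≠ j → ∀ u ∈ K i, ∀ v ∈ K j, G.Adj u v) {X : Finset V}
    (hX : ∀ x ∈ X, ∀ i, s + k ≤ ((K i).filter fun z => G.Adj x z).card) :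
    X.card ≤ 2 ^ ((m + 1) * t) * (s + k) := by
  by_contra! hlt
  let U : Finset V := Finset.univ.biUnion K
  have hU : U.card ≤ (m + 1) * t := by
    simpa using Finset.card_biUnion_le_card_mul (Finset.univ : Finset (Fin (m + 1))) K t
      fun i _ => (hK i).le
  -- More than `s + k` vertices of `X` have the same trace `A`. Of these, `k` are matched into `A ∩
  -- K 0`, and the sets `A ∩ K j.succ` carry the multipartite part.
  obtain ⟨A, hA, hlt'⟩ := Finset.exists_lt_card_fiber_of_mul_lt_card_of_maps_to
    (s := X) (t := U.powerset) (f := fun x => U.filter fun z => G.Adj x z) (n := s + k)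
    (fun x _ => Finset.mem_powerset.2 (Finset.filter_subset _ _)) (by
      rw [Finset.card_powerset]
      exact (Nat.mul_le_mul_right _ (Nat.pow_le_pow_right (by omega) hU)).trans_lt hlt)
  obtain ⟨X', hX', hX'k⟩ := Finset.exists_subset_card_eq (show k ≤ _ by
    exact le_trans (by omega) hlt'.le)
  have hXA : ∀ x ∈ X', ∀ z ∈ A, G.Adj x z := by
    intro x hx z hz
    have := (Finset.mem_filter.1 (hX' hx)).2
    rw [← this] at hz
    exact (Finset.mem_filter.1 hz).2
  have hAK : ∀ i, s + k ≤ (A ∩ K i).card := by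
    intro i
    obtain ⟨x, hx⟩ := Finset.card_pos.1 (Nat.zero_lt_of_lt hlt')
    rw [Finset.mem_filter] at hx
    refine (hX x hx.1 i).trans (Finset.card_le_card fun z hz => ?_)
    rw [Finset.mem_filter] at hz
    rw [← hx.2, Finset.mem_inter, Finset.mem_filter]
    exact ⟨⟨Finset.mem_biUnion.2 ⟨i, mem_univ _, hz.1⟩, hz.2⟩, hz.1⟩
  obtain ⟨A', hA', hA'k⟩ := Finset.exists_subset_card_eq (show k ≤ (A ∩ K 0).card from
    le_trans (by omega) (hAK 0))
  have hA'A : ∀ z ∈ A', z ∈ A := fun z hz => (Finset.mem_inter.1 (hA' hz)).1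
  have hadj : ∀ x ∈ X', ∀ z ∈ A', G.Adj x z := fun x hx z hz => hXA x hx z (hA'A z hz)
  let a : Fin k → V := fun i => (X'.equivFinOfCardEq hX'k).symm i
  let b : Fin k → V := fun i => (A'.equivFinOfCardEq hA'k).symm i
  have ha : ∀ i, a i ∈ X' := fun i => Subtype.prop _
  have hb : ∀ i, b i ∈ A' := fun i => Subtype.prop _
  obtain ⟨f, hf⟩ := exists_copy_matching (G := G) (a := a) (b := b)
    (fun i => hadj _ (ha i) _ (hb i)) (fun i j hij => by simpa using Subtype.ext hij)
    (fun i j hij => by simpa using Subtype.ext hij) fun i j => (hadj _ (ha i) _ (hb j)).ne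
  refine hfree (join_equipartite_isContained f (fun j => A ∩ K j.succ)
    (fun j => le_trans (by omega) (hAK j.succ)) (fun i j hij u hu v hv => ?_)
    fun j d hd w => ?_)
  · exact hKK i.succ j.succ (by simpa using hij) u (Finset.mem_inter.1 hu).2 v
      (Finset.mem_inter.1 hv).2
  · rw [Finset.mem_inter] at hd
    rcases hf w with ⟨i, h⟩ | ⟨i, h⟩
    · exact h ▸ hXA _ (ha i) d hd.1
    · exact h ▸ hKK 0 j.succ (Fin.succ_ne_zero j).symm _ (Finset.mem_inter.1 (hA' (hb i))).2 d hd.2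

/-- Independent sets covering almost all vertices form a near partition. -/
lemma nearPartition_of_indep [Fintype V] {δ R : ℕ} {P : Fin (m + 1) → Finset V}
    (hdeg : ∀ v, (m + 1) * Fintype.card V ≤
      (m + 1) * (Finset.univ.filter fun u => G.Adj v u).card + Fintype.card V + (m + 1))
    (indep : ∀ i, ∀ u ∈ P i, ∀ v ∈ P i, ¬ G.Adj u v)
    (disj : ∀ i j, i ≠ j → Disjoint (P i) (P j))
    (hR : Fintype.card V ≤ ∑ i, (P i).card + R) (hδ : R + m + 1 ≤ δ) :
    NearPartition G (m + 1) δ P := by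
  have hnon : ∀ v, (m + 1) * (Finset.univ.filter fun u => ¬ G.Adj v u).card ≤
      Fintype.card V + (m + 1) := by
    intro v
    have h1 := hdeg v
    have h2 := Finset.card_filter_add_card_filter_not (s := (Finset.univ : Finset V)) (G.Adj v ·)
    rw [Finset.card_univ] at h2
    have h3 := congrArg ((m + 1) * ·) h2
    simp only [mul_add (m + 1)] at h3
    omega
  have hup : ∀ i, (m + 1) * (P i).card ≤ Fintype.card V + (m + 1) := by
    intro i
    rcases (P i).eq_empty_or_nonempty with h | ⟨v, hv⟩
    · simp [h]
    · refine le_trans (Nat.mul_le_mul_left _ (Finset.card_le_card fun u hu => ?_)) (hnon v)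
      simpa using indep i v hv u hu
  -- No class exceeds `n / (m + 1) + 1` and only `R` vertices are left out, so no class is much
  -- smaller either. A vertex misses its own class, which leaves few misses elsewhere.
  have hlow : ∀ i, Fintype.card V ≤ (m + 1) * (P i).card + (m + 1) * (R + m) := by
    intro i
    have h1 := Finset.add_sum_erase Finset.univ (fun i => (P i).card) (mem_univ i)
    have h2 : ∑ j ∈ Finset.univ.erase i, (m + 1) * (P j).card ≤ m * (Fintype.card V + (m + 1)) := by
      simpa using Finset.sum_le_card_nsmul (Finset.univ.erase i) _ _ fun j _ => hup j
    rw [← Finset.mul_sum] at h2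
    have h3 := Nat.mul_le_mul_left (m + 1) hR
    rw [← h1] at h3
    nlinarith
  refine ⟨indep, disj, fun i j hij u hu => ?_, fun i => (hlow i).trans ?_⟩
  · have h1 : P i ∪ ((P j).filter fun v => ¬ G.Adj u v) ⊆
        Finset.univ.filter fun v => ¬ G.Adj u v := by
      intro v hv
      rcases Finset.mem_union.1 hv with hv | hv
      · simpa using indep i u hu v hv
      · simpa using (Finset.mem_filter.1 hv).2
    have h2 := Finset.card_le_card h1
    rw [Finset.card_union_of_disjoint ((disj i j hij).mono_right (Finset.filter_subset _ _))] at h2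
    have h3 := Nat.mul_le_mul_left (m + 1) h2
    have h4 := hnon u
    have h5 := hlow i
    rw [mul_add] at h3
    refine (Nat.le_of_mul_le_mul_left (?_ : (m + 1) * _ ≤ (m + 1) * (R + m + 1))
      (by omega)).trans hδ
    rw [mul_add (m + 1) (R + m) 1]
    omega
  · gcongr
    omega

/-- The adjacency count relative to a complete multipartite subgraph. -/
lemma exists_nearPartition_of_classes [Fintype V]
    (hfree : (join (starForest k 1) (completeEquipartiteGraph m s)).Free G)
    (hdeg : ∀ v, (m + 1) * Fintype.card V ≤
      (m + 1) * (Finset.univ.filter fun u => G.Adj v u).card + Fintype.card V + (m + 1))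
    {t b δ c₀ : ℕ} {K : Fin (m + 1) → Finset V} (hK : ∀ i, (K i).card = t)
    (hKK : ∀ i j, i ≠ j → ∀ u ∈ K i, ∀ v ∈ K j, G.Adj u v)
    (ht : 2 * k * (b + (s + k)) + s + b + 2 * (s + k) ≤ t)
    (hc₀ : c₀ = 2 ^ ((m + 1) * t) * (s + k))
    (hb : ∀ β, b * β ≤ Fintype.card V * (s + k) + t * c₀ + t * (m + 1) →
      c₀ + β + (m + 1) * (2 * k) + m + 1 ≤ δ) :
    ∃ P : Fin (m + 1) → Finset V, NearPartition G (m + 1) δ P := by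
  let d : V → Fin (m + 1) → ℕ := fun x i => ((K i).filter fun z => G.Adj x z).card
  let d' : V → Fin (m + 1) → ℕ := fun x i => ((K i).filter fun z => ¬ G.Adj x z).card
  have hdd : ∀ x i, d x i + d' x i = t := fun x i => by
    rw [← hK i]
    exact Finset.card_filter_add_card_filter_not _
  -- Outside `Ex` a vertex has at most `m * t + (s + k)` neighbours in the classes, while the
  -- average is nearly at least `m * t`. Since each vertex of `Bad` falls short by more than `b`,
  -- there are few of them.
  let Ex : Finset V := Finset.univ.filter fun x => ∀ i, s + k ≤ d x i
  let Bad : Finset V := Finset.univ.filter fun x => ∑ i, d x i + b < m * t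
  have hEx : Ex.card ≤ c₀ := hc₀ ▸ card_exceptional_le hfree hK hKK (X := Ex)
    fun x hx => (Finset.mem_filter.1 hx).2
  have hsum : m * t * Fintype.card V ≤ ∑ x, ∑ i, d x i + t * (m + 1) := by
    have h1 : ∑ x, ∑ i, d x i = ∑ i, ∑ z ∈ K i, (Finset.univ.filter fun u => G.Adj z u).card := by
      rw [Finset.sum_comm]
      refine Finset.sum_congr rfl fun i _ => ?_
      simp only [d, Finset.card_filter]
      rw [Finset.sum_comm]
      simp only [G.adj_comm]
    have h2 : ∑ i : Fin (m + 1), ∑ z ∈ K i, (m + 1) * Fintype.card V ≤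
        ∑ i, ∑ z ∈ K i, ((m + 1) * (Finset.univ.filter fun u => G.Adj z u).card +
          (Fintype.card V + (m + 1))) := by
      refine Finset.sum_le_sum fun i _ => Finset.sum_le_sum fun z _ => ?_
      rw [← add_assoc]
      exact hdeg z
    simp only [Finset.sum_add_distrib, ← Finset.mul_sum, sum_const, hK, smul_eq_mul, card_univ,
      Fintype.card_fin, ← h1] at h2
    refine Nat.le_of_mul_le_mul_left (?_ : (m + 1) * _ ≤ (m + 1) * _) (by omega)
    nlinarith
  have hBad : b * Bad.card ≤ Fintype.card V * (s + k) + t * c₀ + t * (m + 1) := by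
    have h1 : ∀ x, ∑ i, d x i + (if x ∈ Bad then b else 0) ≤
        m * t + (s + k) + if x ∈ Ex then t else 0 := by
      intro x
      by_cases hx : x ∈ Bad
      · have := (Finset.mem_filter.1 hx).2
        rw [if_pos hx]
        omega
      · rw [if_neg hx]
        have hle : ∀ i, d x i ≤ t := fun i => by have := hdd x i; omega
        by_cases hx' : x ∈ Ex
        · rw [if_pos hx']
          have h2 : ∑ i, d x i ≤ (m + 1) * t := by
            simpa using Finset.sum_le_card_nsmul Finset.univ _ _ fun i _ => hle i
          rw [add_mul, one_mul] at h2
          omega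
        · rw [if_neg hx']
          simp only [Ex, mem_filter, mem_univ, true_and, not_forall, not_le] at hx'
          obtain ⟨i, hi⟩ := hx'
          have h2 := Finset.add_sum_erase Finset.univ (d x) (mem_univ i)
          have h3 : ∑ j ∈ Finset.univ.erase i, d x j ≤ m * t := by
            simpa using Finset.sum_le_card_nsmul (Finset.univ.erase i) _ _ fun j _ => hle j
          omega
    have h2 := Finset.sum_le_sum fun x (_ : x ∈ (Finset.univ : Finset V)) => h1 x
    simp only [Finset.sum_add_distrib, sum_const, card_univ, smul_eq_mul, Finset.sum_ite_mem,
      univ_inter] at h2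
    have h3 := Nat.mul_le_mul_left t hEx
    nlinarith
  let Y : Fin (m + 1) → Finset V := fun i => Finset.univ.filter fun x => x ∉ Bad ∧ d x i < s + k
  -- A vertex that is not bad misses at most `t + b` vertices in all, and one of `Y i` misses more
  -- than `t - (s + k)` in `K i` alone.
  have hY : ∀ i, ∀ x ∈ Y i, ∀ j, j ≠ i → d' x j ≤ b + (s + k) := by
    intro i x hx j hij
    simp only [Y, Bad, mem_filter, mem_univ, true_and, not_lt] at hx
    have h1 : ∑ l, d x l + ∑ l, d' x l = (m + 1) * t := by
      rw [← Finset.sum_add_distrib, Finset.sum_congr rfl fun l _ => hdd x l]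
      simp
    have h2 : d' x i + d' x j ≤ ∑ l, d' x l := by
      rw [← Finset.sum_pair hij.symm]
      exact Finset.sum_le_sum_of_subset (Finset.subset_univ _)
    have h3 := hdd x i
    rw [add_mul, one_mul] at h1
    omega
  have hC : ∀ i, ∃ C ⊆ Y i, C.card ≤ 2 * k ∧ ∀ u ∈ Y i \ C, ∀ v ∈ Y i \ C, ¬ G.Adj u v := by
    intro i
    refine exists_cover_of_near (D := fun j => K (i.succAbove j)) (δ := 0) (l := b + (s + k)) hfree
      (fun a c hac u hu => ?_) (fun j y hy => hY i y hy _ (Fin.succAbove_ne i j)) fun j => ?_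
    · rw [Finset.filter_false_of_mem fun v hv => not_not.2
        (hKK _ _ (by simpa using hac) u hu v hv)]
      simp
    · simp only [hK, mul_zero]
      omega
  choose C hCY hC hind using hC
  refine ⟨fun i => Y i \ C i, nearPartition_of_indep (R := c₀ + Bad.card + (m + 1) * (2 * k)) hdeg
    hind (fun i j hij => ?_) ?_ (hb _ hBad)⟩
  · refine Disjoint.mono Finset.sdiff_subset Finset.sdiff_subset (Finset.disjoint_left.2 ?_)
    intro x hxi hxj
    have h1 := hY i x hxi j hij.symm
    have h2 := hdd x j
    have h3 := (Finset.mem_filter.1 hxj).2.2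
    omega
  · have h1 : (Finset.univ : Finset V) ⊆ (Ex ∪ Bad) ∪ (Finset.univ.biUnion C ∪
        Finset.univ.biUnion fun i => Y i \ C i) := by
      intro x _
      by_cases hx : x ∈ Ex
      · simp [hx]
      by_cases hx' : x ∈ Bad
      · simp [hx']
      have hx2 := hx
      simp only [Ex, mem_filter, mem_univ, true_and, not_forall, not_le] at hx2
      obtain ⟨i, hi⟩ := hx2
      have hxY : x ∈ Y i := Finset.mem_filter.2 ⟨mem_univ _, hx', hi⟩
      refine Finset.mem_union_right _ ?_
      by_cases hxC : x ∈ C i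
      · exact Finset.mem_union_left _ (Finset.mem_biUnion.2 ⟨i, mem_univ _, hxC⟩)
      · exact Finset.mem_union_right _ (Finset.mem_biUnion.2
          ⟨i, mem_univ _, Finset.mem_sdiff.2 ⟨hxY, hxC⟩⟩)
    have h2 := Finset.card_le_card h1
    rw [Finset.card_univ] at h2
    have h3 := Finset.card_union_le (Ex ∪ Bad) (Finset.univ.biUnion C ∪
        Finset.univ.biUnion fun i => Y i \ C i)
    have h4 := Finset.card_union_le Ex Bad
    have h5 := Finset.card_union_le (Finset.univ.biUnion C)
      (Finset.univ.biUnion fun i => Y i \ C i)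
    have h6 : (Finset.univ.biUnion fun i => Y i \ C i).card ≤ ∑ i, (Y i \ C i).card :=
      Finset.card_biUnion_le
    have h7 : (Finset.univ.biUnion C).card ≤ (m + 1) * (2 * k) := by
      simpa using Finset.card_biUnion_le_card_mul (Finset.univ : Finset (Fin (m + 1))) C _
        fun i _ => hC i
    omega

/-- Large graphs with minimum degree about `(1 - 1 / (m + 1)) n` without the given subgraph have an
almost complete multipartite structure. -/
theorem exists_nearPartition (m s k E : ℕ) (hm : 0 < m) (hE : 0 < E) :
    ∃ n₁ : ℕ, ∀ n ≥ n₁, ∀ G : SimpleGraph (Fin n),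
      (join (starForest k 1) (completeEquipartiteGraph m s)).Free G →
      (∀ v, (m + 1) * n ≤ (m + 1) * (Finset.univ.filter fun u => G.Adj v u).card + n + (m + 1)) →
      ∃ P : Fin (m + 1) → Finset (Fin n), NearPartition G (m + 1) (n / E) P := by
  -- With this `b` at most `n / (2 * E)` vertices are bad; the remaining error is bounded and fits
  -- into the other half of `n / E`.
  obtain ⟨b, hb⟩ : ∃ b, b = 2 * E * (s + k + 1) := ⟨_, rfl⟩
  obtain ⟨t, ht⟩ : ∃ t, t = 2 * k * (b + (s + k)) + s + b + 2 * (s + k) := ⟨_, rfl⟩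
  obtain ⟨c₀, hc₀⟩ : ∃ c₀, c₀ = 2 ^ ((m + 1) * t) * (s + k) := ⟨_, rfl⟩
  have hm' : (0 : ℝ) < m := by exact_mod_cast hm
  -- The minimum degree is about `(1 - 1 / m + 1 / (m * (m + 1))) * n`. Half of the last term is the
  -- excess required for Erdős–Stone, the other half absorbs the additive error.
  obtain ⟨N, hN⟩ := Filter.eventually_atTop.1
    (eventually_completeEquipartiteGraph_isContained_of_minDegree
      (show (0 : ℝ) < 1 / (2 * m * (m + 1)) by positivity) m t)
  refine ⟨N + 2 * m * (m + 1) + (t * c₀ + t * (m + 1)) +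
    2 * E * (c₀ + (m + 1) * (2 * k) + m + 1) + 1, fun n hn G hfree hdeg => ?_⟩
  have : Nonempty (Fin n) := ⟨⟨0, by omega⟩⟩
  have hmin : (G.minDegree : ℝ) ≥ (1 - 1 / m + 1 / (2 * m * (m + 1))) * n := by
    obtain ⟨v, hv⟩ := G.exists_minimal_degree_vertex
    have h1 := hdeg v
    have h2 : (Finset.univ.filter fun u => G.Adj v u).card = G.minDegree := by
      rw [hv, ← card_neighborFinset_eq_degree, neighborFinset_eq_filter]
    rw [h2] at h1
    have h3 : ((m + 1 : ℝ)) * n ≤ (m + 1) * G.minDegree + n + (m + 1) := by exact_mod_cast h1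
    have h4 : (2 * m * (m + 1) : ℝ) ≤ n := by
      have : 2 * m * (m + 1) ≤ n := by omega
      exact_mod_cast this
    have h5 : (1 - 1 / m + 1 / (2 * m * (m + 1)) : ℝ) * n =
        (2 * m * (m + 1) * n - 2 * (m + 1) * n + n) / (2 * m * (m + 1)) := by
      field_simp
    rw [ge_iff_le, h5, div_le_iff₀ (by positivity)]
    nlinarith
  obtain ⟨κ⟩ := hN n (by omega) hmin
  refine exists_nearPartition_of_classes hfree (by simpa using hdeg) (t := t) (b := b) (c₀ := c₀)
    (K := fun i => Finset.univ.image fun j => κ (i, j)) (fun i => ?_) ?_ ht.ge hc₀ ?_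
  · rw [Finset.card_image_of_injective _ fun a c hac => by simpa using κ.injective hac]
    simp
  · intro i j hij u hu v hv
    obtain ⟨a, -, rfl⟩ := Finset.mem_image.1 hu
    obtain ⟨c, -, rfl⟩ := Finset.mem_image.1 hv
    exact κ.toHom.map_adj (by simpa using hij)
  · intro β hβ
    rw [Fintype.card_fin] at hβ
    rw [Nat.le_div_iff_mul_le hE]
    have h1 : (s + k + 1) * (2 * E * β) ≤ (s + k + 1) * n := by
      have : (s + k + 1) * (2 * E * β) = b * β := by rw [hb]; ring
      rw [this]
      refine hβ.trans ?_
      have h3 : (s + k + 1) * n = n * (s + k) + n := by ring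
      omega
    have h2 := Nat.le_of_mul_le_mul_left h1 (by omega)
    have h3 : (c₀ + β + (m + 1) * (2 * k) + m + 1) * E * 2 =
      2 * E * β + 2 * E * (c₀ + (m + 1) * (2 * k) + m + 1) := by ring
    omega

end

/-! ### The structure theorem with explicit constants, and edge counts -/

section

/-- Large graphs with large minimum degree and large degree sums of cliques that avoid the given
subgraphs are joins of a small graph and a multipartite graph, up to missing edges. -/
theorem exists_structure (m r s k : ℕ) (hm : 0 < m) :
    ∃ n₁ : ℕ, ∀ n ≥ n₁, ∀ G : SimpleGraph (Fin n),
      (join (starForest k 1) (completeEquipartiteGraph m s)).Free G →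
      (join (starForest r s ⊕g (⊤ : SimpleGraph (Fin 2)))
        (completeEquipartiteGraph m s)).Free G →
      (∀ v, (m + 1) * n ≤ (m + 1) * (Finset.univ.filter fun u => G.Adj v u).card + n + (m + 1)) →
      (∀ z : Fin (m + 1) → Fin n, (∀ i j, i ≠ j → G.Adj (z i) (z j)) →
        m * n + r ≤ ∑ i, (Finset.univ.filter fun u => G.Adj (z i) u).card) →
      ∃ X : Finset (Fin n), X.card = r ∧
        (∃ c : Fin n → Fin (m + 1), ∀ u v, u ∉ X → v ∉ X → G.Adj u v → c u ≠ c v) ∧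
        join (G.induce (X : Set (Fin n))) (completeEquipartiteGraph (m + 1) s) ⊑ G := by
  obtain ⟨b, hb⟩ : ∃ b, b = 64 * (m + 1) * (k + 1) := ⟨_, rfl⟩
  obtain ⟨c, hc⟩ : ∃ c, c = 2 ^ ((r + 1) * (2 * (129 * (k + 1))) ^ (m + 1) + 1) := ⟨_, rfl⟩
  obtain ⟨d, hd⟩ : ∃ d, d = m * s + r * s + m + s + r + 2 * k + 4 := ⟨_, rfl⟩
  have hb0 : 0 < b := by rw [hb]; positivity
  have hc0 : 0 < c := by rw [hc]; positivity
  have hd0 : 0 < d := by omega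
  -- The hierarchy is `h = n / b`, `g = h / c`, `δ = g / (2 * d)`. The factor `2` makes half of `g`
  -- absorb `d * δ` and the other half `d`.
  obtain ⟨n₁, hn₁⟩ := exists_nearPartition m s k (b * c * (2 * d)) hm (by positivity)
  refine ⟨n₁ + b * c * (2 * d), fun n hn G hmatch hstar hdeg hclique => ?_⟩
  obtain ⟨P, hP⟩ := hn₁ n (by omega) G hmatch hdeg
  have h1 : 2 * d ≤ n / b / c := by
    rw [Nat.div_div_eq_div_mul, Nat.le_div_iff_mul_le (by positivity), mul_comm]
    omega
  have h2 : n / b / c * c ≤ n / b := Nat.div_mul_le_self _ _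
  have h3 : n / b / c ≤ n / b := Nat.div_le_self _ _
  refine hP.exists_structure hmatch hstar (by simpa using hdeg) (by simpa using hclique)
    (h := n / b) (g := n / b / c) ?_ ?_ (hc ▸ h2) ?_
  · rw [← hb, Fintype.card_fin, mul_comm]
    exact Nat.div_mul_le_self _ _
  · have h4 := Nat.lt_mul_div_succ n hb0
    have h5 : 128 * (m + 1) * (k + 1) * (n / b) = b * (n / b) + b * (n / b) := by rw [hb]; ring
    have h6 : b ≤ b * (n / b) := Nat.le_mul_of_pos_right _ (by omega)
    rw [mul_add, mul_one] at h4
    rw [h5, Fintype.card_fin]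
    omega
  · have h6 : n / (b * c * (2 * d)) = n / b / c / (2 * d) := by
      rw [Nat.div_div_eq_div_mul n b, Nat.div_div_eq_div_mul]
    rw [← hd, h6]
    have h4 := Nat.mul_div_le (n / b / c) (2 * d)
    rw [mul_add, mul_one]
    have h5 : 2 * d * (n / b / c / (2 * d)) = 2 * (d * (n / b / c / (2 * d))) := by ring
    omega

/-! ### Counting edges -/

section Count

variable {V W : Type*} {G : SimpleGraph V} {H : SimpleGraph W}

lemma two_mul_ncard_edgeSet [Fintype V] (G : SimpleGraph V) :
    2 * G.edgeSet.ncard = ∑ v, ∑ u, if G.Adj v u then 1 else 0 := by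
  rw [Set.ncard_eq_toFinset_card', ← edgeFinset, ← sum_degrees_eq_twice_card_edges]
  refine Finset.sum_congr rfl fun v _ => ?_
  rw [← card_neighborFinset_eq_degree, neighborFinset_eq_filter, Finset.card_filter]

lemma two_mul_ncard_edgeSet_induce (G : SimpleGraph V) (X : Finset V) :
    2 * (G.induce (X : Set V)).edgeSet.ncard =
      ∑ v ∈ X, ∑ u ∈ X, if G.Adj v u then 1 else 0 := by
  rw [two_mul_ncard_edgeSet,
    ← Finset.sum_finset_coe (fun v => ∑ u ∈ X, if G.Adj v u then 1 else 0) X]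
  refine Finset.sum_congr rfl fun v _ => ?_
  rw [← Finset.sum_finset_coe (fun u => if G.Adj v u then 1 else 0) X]
  simp

variable [Fintype V] [Fintype W]

lemma ncard_edgeSet_eq (G : SimpleGraph V) [DecidableRel G.Adj] :
    G.edgeSet.ncard = G.edgeFinset.card := by
  rw [Set.ncard_eq_toFinset_card', edgeFinset]

lemma ncard_edgeSet_congr (e : G ≃g H) : G.edgeSet.ncard = H.edgeSet.ncard := by
  rw [ncard_edgeSet_eq, ncard_edgeSet_eq, e.card_edgeFinset_eq]

lemma ncard_edgeSet_join (G : SimpleGraph V) (H : SimpleGraph W) :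
    (join G H).edgeSet.ncard =
      G.edgeSet.ncard + Fintype.card V * Fintype.card W + H.edgeSet.ncard := by
  have h := two_mul_ncard_edgeSet (join G H)
  have hG := two_mul_ncard_edgeSet G
  have hH := two_mul_ncard_edgeSet H
  simp only [Fintype.sum_sum_type, join_adj_inl_inl, join_adj_inl_inr, join_adj_inr_inl,
    join_adj_inr_inr, if_true, Finset.sum_add_distrib, sum_const, card_univ, smul_eq_mul,
    mul_one] at h
  rw [← hG, ← hH, mul_comm (Fintype.card W)] at h
  omega

lemma ncard_edgeSet_split (G : SimpleGraph V) (X : Finset V) :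
    G.edgeSet.ncard = (G.induce (X : Set V)).edgeSet.ncard +
      (∑ v ∈ X, ∑ u ∈ Xᶜ, if G.Adj v u then 1 else 0) +
      (G.induce ((Xᶜ : Finset V) : Set V)).edgeSet.ncard := by
  have h := two_mul_ncard_edgeSet G
  have h1 := two_mul_ncard_edgeSet_induce G X
  have h2 := two_mul_ncard_edgeSet_induce G Xᶜ
  have h3 : ∑ v ∈ Xᶜ, ∑ u ∈ X, (if G.Adj v u then 1 else 0) =
      ∑ v ∈ X, ∑ u ∈ Xᶜ, if G.Adj v u then 1 else 0 := by
    rw [Finset.sum_comm]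
    simp only [G.adj_comm]
  rw [← Finset.sum_add_sum_compl X] at h
  simp only [← Finset.sum_add_sum_compl X, Finset.sum_add_distrib] at h
  omega

/-- The number of edges after the removal of a set of vertices. -/
lemma ncard_edgeSet_add_induce (G : SimpleGraph V) (X : Finset V) :
    G.edgeSet.ncard + (G.induce (X : Set V)).edgeSet.ncard =
      (G.induce ((Xᶜ : Finset V) : Set V)).edgeSet.ncard +
        ∑ v ∈ X, (Finset.univ.filter fun u => G.Adj v u).card := by
  have h := ncard_edgeSet_split G X
  have h1 := two_mul_ncard_edgeSet_induce G X
  have h2 : ∑ v ∈ X, (Finset.univ.filter fun u => G.Adj v u).card =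
      ∑ v ∈ X, (∑ u ∈ X, if G.Adj v u then 1 else 0) +
      ∑ v ∈ X, ∑ u ∈ Xᶜ, if G.Adj v u then 1 else 0 := by
    rw [← Finset.sum_add_distrib]
    refine Finset.sum_congr rfl fun v _ => ?_
    rw [Finset.card_filter, Finset.sum_add_sum_compl]
  omega

lemma ncard_edgeSet_le_extremalNumber {U : Type*} {L : SimpleGraph U} (h : L.Free G) :
    G.edgeSet.ncard ≤ extremalNumber (Fintype.card V) L := by
  rw [ncard_edgeSet_eq]
  exact card_edgeFinset_le_extremalNumber h

lemma ncard_edgeSet_add_induce_le {U : Type*} {L : SimpleGraph U} (h : L.Free G) (X : Finset V) :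
    G.edgeSet.ncard + (G.induce (X : Set V)).edgeSet.ncard ≤
      extremalNumber (Fintype.card V - X.card) L +
        ∑ v ∈ X, (Finset.univ.filter fun u => G.Adj v u).card := by
  rw [ncard_edgeSet_add_induce]
  refine Nat.add_le_add_right ?_ _
  have h1 : L.Free (G.induce ((Xᶜ : Finset V) : Set V)) := fun hL =>
    h (hL.trans ⟨Copy.induce G _⟩)
  have h2 := ncard_edgeSet_le_extremalNumber h1
  have h3 : Fintype.card ((Xᶜ : Finset V) : Set V) = Fintype.card V - X.card := by
    rw [← Finset.card_compl]
    exact Fintype.card_coe _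
  rwa [h3] at h2

/-- Turán's theorem for colorable graphs. -/
lemma ncard_edgeSet_le_of_colorable {p : ℕ} (hp : 0 < p) (h : G.Colorable p) :
    G.edgeSet.ncard ≤ (turanGraph (Fintype.card V) p).edgeSet.ncard ∧
      (G.edgeSet.ncard = (turanGraph (Fintype.card V) p).edgeSet.ncard →
        Nonempty (G ≃g turanGraph (Fintype.card V) p)) := by
  have hfree : G.CliqueFree (p + 1) := h.cliqueFree (Nat.lt_succ_self p)
  obtain ⟨H, _, hH⟩ := exists_isTuranMaximal (V := V) hp
  obtain ⟨e⟩ := (isTuranMaximal_iff_nonempty_iso_turanGraph hp).1 hH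
  have he : (turanGraph (Fintype.card V) p).edgeSet.ncard = H.edgeSet.ncard :=
    (ncard_edgeSet_congr e).symm
  rw [he, ncard_edgeSet_eq, ncard_edgeSet_eq]
  refine ⟨hH.2 hfree, fun heq => (isTuranMaximal_iff_nonempty_iso_turanGraph hp).1
    ⟨hfree, fun G' _ hG' => ?_⟩⟩
  exact (hH.2 hG').trans heq.ge

lemma ncard_turanGraph_add (n p : ℕ) : (turanGraph (n + p) p).edgeSet.ncard =
    (turanGraph n p).edgeSet.ncard + n * (p - 1) + p.choose 2 := by
  rw [ncard_edgeSet_eq, ncard_edgeSet_eq, card_edgeFinset_turanGraph_add]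

/-- The new vertex has number `n` and misses exactly the `n / p` smaller numbers congruent to it. -/
lemma ncard_turanGraph_succ (n : ℕ) {p : ℕ} (hp : 0 < p) :
    (turanGraph (n + 1) p).edgeSet.ncard + n / p = (turanGraph n p).edgeSet.ncard + n := by
  have h := two_mul_ncard_edgeSet (turanGraph (n + 1) p)
  have h1 := two_mul_ncard_edgeSet (turanGraph n p)
  simp only [Fin.sum_univ_castSucc, turanGraph_adj, Fin.val_castSucc, Fin.val_last,
    Finset.sum_add_distrib] at h h1
  have h2 : ∑ x : Fin n, (if n % p ≠ (x : ℕ) % p then 1 else 0) =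
      ∑ x : Fin n, if (x : ℕ) % p ≠ n % p then 1 else 0 := by
    simp only [ne_comm]
  have h3 : ∑ x : Fin n, (if (x : ℕ) % p ≠ n % p then 1 else 0) + n / p = n := by
    have h4 := Nat.count_modEq_card n hp n
    rw [if_neg (lt_irrefl _), add_zero, Nat.count_eq_card_filter_range] at h4
    rw [Fin.sum_univ_eq_sum_range (fun x => if x % p ≠ n % p then 1 else 0), ← Finset.card_filter,
      ← h4]
    have h5 := Finset.card_filter_add_card_filter_not (s := Finset.range n) (fun x => x % p = n % p)
    rw [Finset.card_range] at h5
    rw [add_comm]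
    simp only [Nat.ModEq]
    convert! h5
  simp only [ne_eq, not_true_eq_false, if_false, add_zero] at h h1 h2 h3
  omega

end Count

end

section

/-! ### Extremal graphs -/

section Iso

variable {V V' W W' : Type*} {G : SimpleGraph V} {G' : SimpleGraph V'} {H : SimpleGraph W}
  {H' : SimpleGraph W'}

/-- The join of isomorphic graphs. -/
def joinCongr (e : G ≃g G') (f : H ≃g H') : join G H ≃g join G' H' where
  toEquiv := Equiv.sumCongr e.toEquiv f.toEquiv
  map_rel_iff' := by
    rintro (a | a) (b | b)
    · simpa using e.map_adj_iff
    · simp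
    · simp
    · simpa using f.map_adj_iff

/-- A graph is the join of two complementary induced subgraphs that are completely joined. -/
lemma nonempty_iso_join_induce [Fintype V] (X : Finset V)
    (h : ∀ u ∈ X, ∀ v ∈ Xᶜ, G.Adj u v) :
    Nonempty (G ≃g join (G.induce (X : Set V)) (G.induce ((Xᶜ : Finset V) : Set V))) := by
  let g : (X : Set V) ⊕ ((Xᶜ : Finset V) : Set V) → V := Sum.elim (↑) (↑)
  have hg : Function.Bijective g := by
    refine ⟨?_, fun v => ?_⟩
    · rintro (⟨a, ha⟩ | ⟨a, ha⟩) (⟨b, hb⟩ | ⟨b, hb⟩) (hab : a = b)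
      · simp [hab]
      · subst hab
        exact absurd ha (by simpa using hb)
      · subst hab
        exact absurd hb (by simpa using ha)
      · simp [hab]
    · by_cases hv : v ∈ X
      · exact ⟨.inl ⟨v, by simpa using hv⟩, rfl⟩
      · exact ⟨.inr ⟨v, by simpa using hv⟩, rfl⟩
  refine ⟨RelIso.symm ⟨Equiv.ofBijective g hg, ?_⟩⟩
  rintro (⟨a, ha⟩ | ⟨a, ha⟩) (⟨b, hb⟩ | ⟨b, hb⟩)
  · simp [g]
  · simpa [g] using h a (by simpa using ha) b (by simpa using hb)
  · simpa [g] using (h b (by simpa using hb) a (by simpa using ha)).symm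
  · simp [g]

end Iso

variable {U : Type*} {L : SimpleGraph U} {m r s k : ℕ}

/-- The extremal problem under the degree conditions. -/
lemma ncard_edgeSet_le_of_structure {V : Type*} [Fintype V] {n x : ℕ} {G : SimpleGraph V}
    (hn : Fintype.card V = n)
    (hG : L.Free G) {good : SimpleGraph (Fin r) → Prop}
    (hgood : ∀ Q, L.Free (join Q (completeEquipartiteGraph (m + 1) s)) → good Q)
    (hx : ∀ Q, good Q → Q.edgeSet.ncard ≤ x) {X : Finset V} (hX : X.card = r)
    (hc : ∃ c : V → Fin (m + 1), ∀ u v, u ∉ X → v ∉ X → G.Adj u v → c u ≠ c v)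
    (hjoin : join (G.induce (X : Set V)) (completeEquipartiteGraph (m + 1) s) ⊑ G) :
    G.edgeSet.ncard ≤ r * (n - r) + (turanGraph (n - r) (m + 1)).edgeSet.ncard + x ∧
      (G.edgeSet.ncard = r * (n - r) + (turanGraph (n - r) (m + 1)).edgeSet.ncard + x →
        ∃ Q, good Q ∧ Q.edgeSet.ncard = x ∧
          Nonempty (G ≃g join Q (turanGraph (n - r) (m + 1)))) := by
  let Q : SimpleGraph (Fin r) := (G.induce (X : Set V)).comap (X.equivFinOfCardEq hX).symm
  let e : Q ≃g G.induce (X : Set V) := ⟨(X.equivFinOfCardEq hX).symm, Iff.rfl⟩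
  have hQ : good Q := hgood Q fun hL => hG (hL.trans
    ((join_isContained_join e.isContained (IsContained.refl _)).trans hjoin))
  have hQx := hx Q hQ
  have heQ : Q.edgeSet.ncard = (G.induce (X : Set V)).edgeSet.ncard := ncard_edgeSet_congr e
  have hXc : Xᶜ.card = n - r := by rw [Finset.card_compl, hn, hX]
  have hcard : Fintype.card ((Xᶜ : Finset V) : Set V) = n - r := by
    rw [← hXc]
    exact Fintype.card_coe _
  have hcol : (G.induce ((Xᶜ : Finset V) : Set V)).Colorable (m + 1) := by
    obtain ⟨c, hc⟩ := hc
    exact ⟨Coloring.mk (fun v => c v) fun {u v} huv =>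
      hc u v (by simpa using u.2) (by simpa using v.2) huv⟩
  have hT := ncard_edgeSet_le_of_colorable (show 0 < m + 1 by omega) hcol
  rw [hcard] at hT
  have hcross : ∀ v ∈ X, (∑ u ∈ Xᶜ, if G.Adj v u then 1 else 0) ≤ n - r := by
    intro v _
    rw [← Finset.card_filter, ← hXc]
    exact Finset.card_le_card (Finset.filter_subset _ _)
  have hcross' : (∑ v ∈ X, ∑ u ∈ Xᶜ, if G.Adj v u then 1 else 0) ≤ r * (n - r) := by
    rw [← hX]
    exact Finset.sum_le_card_nsmul _ _ _ (hX ▸ hcross)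
  have hsplit := ncard_edgeSet_split G X
  -- The edges inside `X`, across, and outside `X` are bounded separately, so equality in total
  -- forces equality in each.
  refine ⟨by omega, fun heq => ⟨Q, hQ, by omega, ?_⟩⟩
  obtain ⟨f⟩ := hT.2 (by omega)
  have hall : ∀ v ∈ X, (∑ u ∈ Xᶜ, if G.Adj v u then 1 else 0) = n - r := by
    refine (Finset.sum_eq_sum_iff_of_le hcross).1 ?_
    rw [Finset.sum_const, smul_eq_mul, hX]
    omega
  obtain ⟨g⟩ := nonempty_iso_join_induce (G := G) X fun u hu v hv => by
    have h1 := hall u hu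
    rw [← Finset.card_filter, ← hXc, Finset.card_filter_eq_iff] at h1
    exact h1 v hv
  exact ⟨g.trans (joinCongr e.symm f)⟩

/-- Progressive induction. -/
lemma eventually_of_progressive {φ : ℕ → ℕ} {S : ℕ → Prop} {p n₂ : ℕ}
    (hS : ∀ n, S n → φ n = 0)
    (hstep : ∀ n ≥ n₂, ¬ S n → ∃ d, 1 ≤ d ∧ d ≤ p ∧ d ≤ n ∧ φ n + 1 ≤ φ (n - d)) :
    ∃ n₀, ∀ n ≥ n₀, S n := by
  obtain ⟨M, hM⟩ : ∃ M, ∀ j < n₂, φ j ≤ M :=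
    ⟨(Finset.range n₂).sup φ, fun j hj => Finset.le_sup (f := φ) (Finset.mem_range.2 hj)⟩
  -- From `n` to `n - d` the quantity `p * φ n + n` gains at least `p` and loses `d ≤ p`. The number
  -- `n - d` is again a failure because `φ` is positive there.
  have key : ∀ n, (n < n₂ ∨ ¬ S n) → p * φ n + n ≤ p * M + n₂ := by
    intro n
    induction n using Nat.strong_induction_on with
    | _ n ih =>
      intro h
      by_cases hn : n < n₂
      · have := Nat.mul_le_mul_left p (hM n hn)
        omega
      · obtain ⟨d, h1, h2, h3, h4⟩ := hstep n (by omega) (h.resolve_left hn)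
        have h5 := ih (n - d) (by omega) (.inr fun hs => by have := hS _ hs; omega)
        have h6 := Nat.mul_le_mul_left p h4
        rw [mul_add, mul_one] at h6
        omega
  refine ⟨p * M + n₂ + 1, fun n hn => ?_⟩
  by_contra h
  have := key n (.inr h)
  have : n ≤ p * φ n + n := Nat.le_add_left _ _
  omega

/-- The extremal graphs for a graph `L` that embeds into the join of a matching and a complete
multipartite graph, and into the join of `r` stars and an edge and a complete multipartite graph. -/
theorem extremal_of_starForest (hm : 0 < m) (hL : L ≠ ⊥)
    (hmatch : L ⊑ join (starForest k 1) (completeEquipartiteGraph m s))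
    (hstar : L ⊑ join (starForest r s ⊕g (⊤ : SimpleGraph (Fin 2))) (completeEquipartiteGraph m s))
    {good : SimpleGraph (Fin r) → Prop}
    (hgood : ∀ Q, L.Free (join Q (completeEquipartiteGraph (m + 1) s)) → good Q)
    (hgood' : ∀ Q, good Q → ∀ n, L.Free (join Q (turanGraph n (m + 1))))
    {x : ℕ} (hx : ∀ Q, good Q → Q.edgeSet.ncard ≤ x) (hx' : ∃ Q, good Q ∧ Q.edgeSet.ncard = x) :
    ∃ n₀ : ℕ, ∀ n ≥ n₀,
      extremalNumber n L = r * (n - r) + (turanGraph (n - r) (m + 1)).edgeSet.ncard + x ∧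
      ∀ G : SimpleGraph (Fin n), (L.Free G ∧ G.edgeSet.ncard = extremalNumber n L) ↔
        ∃ Q, (good Q ∧ Q.edgeSet.ncard = x) ∧
          Nonempty (G ≃g join Q (turanGraph (n - r) (m + 1))) := by
  obtain ⟨n₁, hn₁⟩ := exists_structure m r s k hm
  obtain ⟨t, ht⟩ : ∃ t : ℕ → ℕ, ∀ n, t n = (turanGraph n (m + 1)).edgeSet.ncard :=
    ⟨_, fun _ => rfl⟩
  obtain ⟨h, hh⟩ : ∃ h : ℕ → ℕ, ∀ n, h n = r * (n - r) + t (n - r) + x := ⟨_, fun _ => rfl⟩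
  have hcount : ∀ n ≥ r, ∀ Q : SimpleGraph (Fin r), Q.edgeSet.ncard = x →
      (join Q (turanGraph (n - r) (m + 1))).edgeSet.ncard = h n := by
    intro n _ Q hQ
    rw [ncard_edgeSet_join, hQ, Fintype.card_fin, Fintype.card_fin, hh, ht]
    omega
  have hlow : ∀ n ≥ r, h n ≤ extremalNumber n L := by
    intro n hn
    obtain ⟨Q, hQ, hQx⟩ := hx'
    have h1 := ncard_edgeSet_le_extremalNumber (hgood' Q hQ (n - r))
    rwa [hcount n hn Q hQx, Fintype.card_sum, Fintype.card_fin, Fintype.card_fin,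
      Nat.add_sub_cancel' hn] at h1
  let S : ℕ → Prop := fun n => r ≤ n ∧ extremalNumber n L = h n ∧
    ∀ G : SimpleGraph (Fin n), L.Free G → G.edgeSet.ncard = extremalNumber n L →
      ∃ Q, (good Q ∧ Q.edgeSet.ncard = x) ∧ Nonempty (G ≃g join Q (turanGraph (n - r) (m + 1)))
  have hstep : ∀ n ≥ n₁ + r + m + 1, ¬ S n → ∃ d, 1 ≤ d ∧ d ≤ m + 1 ∧ d ≤ n ∧
      extremalNumber n L - h n + 1 ≤ extremalNumber (n - d) L - h (n - d) := by
    intro n hn hS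
    have hbad : ∃ G : SimpleGraph (Fin n), L.Free G ∧ G.edgeSet.ncard = extremalNumber n L ∧
        ¬ ((∀ v, (m + 1) * n ≤
            (m + 1) * (Finset.univ.filter fun u => G.Adj v u).card + n + (m + 1)) ∧
          ∀ z : Fin (m + 1) → Fin n, (∀ i j, i ≠ j → G.Adj (z i) (z j)) →
            m * n + r ≤ ∑ i, (Finset.univ.filter fun u => G.Adj (z i) u).card) := by
      by_contra hno
      have hall := fun G hG hGe => not_not.1 fun hb => hno ⟨G, hG, hGe, hb⟩
      have hstr : ∀ G : SimpleGraph (Fin n), L.Free G → G.edgeSet.ncard = extremalNumber n L →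
          G.edgeSet.ncard ≤ h n ∧ (G.edgeSet.ncard = h n → ∃ Q, good Q ∧ Q.edgeSet.ncard = x ∧
          Nonempty (G ≃g join Q (turanGraph (n - r) (m + 1)))) := by
        intro G hG hGe
        obtain ⟨hdeg, hclique⟩ := hall G hG hGe
        obtain ⟨X, hX, hc, hjoin⟩ := hn₁ n (by omega) G (fun h => hG (hmatch.trans h))
          (fun h => hG (hstar.trans h)) hdeg hclique
        rw [hh, ht]
        exact ncard_edgeSet_le_of_structure (Fintype.card_fin n) hG hgood hx hX hc hjoin
      obtain ⟨G, _, hGext⟩ := exists_isExtremal_free (V := Fin n) hL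
      rw [isExtremal_free_iff, Fintype.card_fin, ← ncard_edgeSet_eq] at hGext
      have h1 := (hstr G hGext.1 hGext.2).1
      have h2 := hlow n (by omega)
      have h3 : extremalNumber n L = h n := by omega
      refine hS ⟨by omega, h3, fun G' hG' hGe' => ?_⟩
      obtain ⟨Q, hQ, hQx, hiso⟩ := (hstr G' hG' hGe').2 (hGe'.trans h3)
      exact ⟨Q, ⟨hQ, hQx⟩, hiso⟩
    obtain ⟨G, hG, hGe, hbad⟩ := hbad
    have hlown := hlow n (by omega)
    rw [not_and_or] at hbad
    rcases hbad with hbad | hbad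
    · push Not at hbad
      obtain ⟨v, hv⟩ := hbad
      refine ⟨1, le_rfl, by omega, by omega, ?_⟩
      -- The degree of `v` is smaller than `h n - h (n - 1) = n - 1 - (n - 1 - r) / (m + 1)`.
      have h1 := ncard_edgeSet_add_induce_le hG {v}
      rw [Finset.card_singleton, Finset.sum_singleton, Fintype.card_fin, hGe] at h1
      have h2 := ncard_turanGraph_succ (n - 1 - r) (show 0 < m + 1 by omega)
      rw [← ht, ← ht, show n - 1 - r + 1 = n - r by omega] at h2
      have h3 : n / (m + 1) < n - (Finset.univ.filter fun u => G.Adj v u).card - 1 := by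
        rw [Nat.div_lt_iff_lt_mul (show 0 < m + 1 by omega), Nat.sub_mul, Nat.sub_mul, mul_comm n,
          mul_comm (Finset.card _), one_mul]
        omega
      have h4 : (n - 1 - r) / (m + 1) ≤ n / (m + 1) := Nat.div_le_div_right (by omega)
      have h5 : r * (n - r) = r * (n - 1 - r) + r := by
        rw [show n - r = n - 1 - r + 1 by omega]
        ring
      rw [hh] at hlown
      rw [hh, hh]
      generalize n / (m + 1) = a, (n - 1 - r) / (m + 1) = b at h2 h3 h4
      omega
    · push Not at hbad
      obtain ⟨z, hz, hlt⟩ := hbad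
      have hinj : Function.Injective z := fun i j hij => by
        by_contra hne
        exact (hz i j hne).ne hij
      refine ⟨m + 1, by omega, le_rfl, by omega, ?_⟩
      -- Deleting the clique costs its degree sum minus its `(m + 1).choose 2` edges, which that sum
      -- counts twice. For a sum below `m * n + r` this is less than `h n - h (n - (m + 1))`.
      have h1 := ncard_edgeSet_add_induce_le hG (Finset.univ.image z)
      rw [Finset.card_image_of_injective _ hinj, Finset.sum_image fun i _ j _ hij => hinj hij,
        Fintype.card_fin, Finset.card_univ, Fintype.card_fin, hGe] at h1
      have h2 := ncard_turanGraph_add (n - (m + 1) - r) (m + 1)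
      rw [← ht, ← ht, show n - (m + 1) - r + (m + 1) = n - r by omega, Nat.add_sub_cancel] at h2
      have h3 := two_mul_ncard_edgeSet_induce G (Finset.univ.image z)
      rw [Finset.sum_image fun i _ j _ hij => hinj hij] at h3
      have h4 : ∀ i, (∑ u ∈ Finset.univ.image z, if G.Adj (z i) u then 1 else 0) = m := by
        intro i
        rw [Finset.sum_image fun i _ j _ hij => hinj hij, ← Finset.card_filter]
        have : (Finset.univ.filter fun j => G.Adj (z i) (z j)) = Finset.univ.erase i := by
          ext j
          simp only [mem_filter, mem_univ, true_and, mem_erase, and_true]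
          exact ⟨fun hij hji => hij.ne (congrArg z hji.symm), fun hij => hz i j fun h => hij h.symm⟩
        rw [this]
        simp
      simp only [h4, sum_const, card_univ, Fintype.card_fin, smul_eq_mul] at h3
      have h5 : 2 * (m + 1).choose 2 = (m + 1) * m := by
        rw [mul_comm, Nat.choose_two_right, Nat.add_sub_cancel,
          Nat.div_two_mul_two_of_even (by simpa using Nat.even_mul_pred_self (m + 1))]
      obtain ⟨l, rfl⟩ : ∃ l, n = l + (m + 1) + r := ⟨n - (m + 1) - r, by omega⟩
      rw [show l + (m + 1) + r - (m + 1) - r = l by omega,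
        show l + (m + 1) + r - r = l + (m + 1) by omega] at h2
      rw [hh, show l + (m + 1) + r - r = l + (m + 1) by omega] at hlown
      rw [hh, hh, show l + (m + 1) + r - r = l + (m + 1) by omega,
        show l + (m + 1) + r - (m + 1) - r = l by omega]
      have h6 : m * (l + (m + 1) + r) + r + r * l = l * m + (m + 1) * m + r * (l + (m + 1)) := by
        ring
      omega
  obtain ⟨n₀, hn₀⟩ := eventually_of_progressive (S := S)
    (φ := fun n => extremalNumber n L - h n) (fun n hn => by simp [hn.2.1]) hstep
  refine ⟨n₀, fun n hn => ?_⟩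
  obtain ⟨hrn, hex, hall⟩ := hn₀ n hn
  rw [← ht, ← hh]
  refine ⟨hex, fun G => ⟨fun hG => hall G hG.1 hG.2, ?_⟩⟩
  rintro ⟨Q, ⟨hQ, hQx⟩, ⟨e⟩⟩
  refine ⟨fun hLG => hgood' Q hQ (n - r) (hLG.trans e.isContained), ?_⟩
  rw [ncard_edgeSet_congr e, hcount n hrn Q hQx, hex]

end

section

/-! ### Decomposition families -/

section Decomposition

variable {U W : Type*} {L : SimpleGraph U} {H : SimpleGraph W} {m : ℕ}

/-- A copy in a join from an assignment of the vertices to the first graph or to `m` colors. -/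
lemma isContained_join_of_coloring [Fintype U] (ψ : U → W ⊕ Fin m)
    (hadj : ∀ x y a b, L.Adj x y → ψ x = .inl a → ψ y = .inl b → H.Adj a b)
    (hinj : ∀ x y a, ψ x = .inl a → ψ y = .inl a → x = y)
    (hcol : ∀ x y i, L.Adj x y → ψ x = .inr i → ψ y ≠ .inr i) :
    L ⊑ join H (completeEquipartiteGraph m (Fintype.card U)) := by
  let f : U → W ⊕ Fin m × Fin (Fintype.card U) := fun x =>
    Sum.map id (fun i => (i, Fintype.equivFin U x)) (ψ x)
  refine ⟨⟨⟨f, fun {x y} h => ?_⟩, fun x y h => ?_⟩⟩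
  · rcases hx : ψ x with a | i <;> rcases hy : ψ y with b | j <;>
      simp only [f, hx, hy, Sum.map_inl, Sum.map_inr, id, join_adj_inl_inl, join_adj_inl_inr,
        join_adj_inr_inl, join_adj_inr_inr]
    · exact hadj x y a b h hx hy
    · intro hij
      obtain rfl : i = j := hij
      exact hcol x y i h hx hy
  · change f x = f y at h
    rcases hx : ψ x with a | i <;> rcases hy : ψ y with b | j <;>
      simp only [f, hx, hy, Sum.map_inl, Sum.map_inr, id, reduceCtorEq, Sum.inl.injEq,
        Sum.inr.injEq, Prod.mk.injEq, EmbeddingLike.apply_eq_iff_eq] at h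
    · subst h
      exact hinj x y a hx hy
    · exact h.2

lemma decomposes_of_isContained {n s : ℕ} {M : SimpleGraph (Fin n)}
    (hχ : L.chromaticNumber.toNat - 2 = m)
    (h : L ⊑ join M (completeEquipartiteGraph m s)) : Decomposes L M := by
  refine ⟨0, m * s, h.trans ?_⟩
  rw [hχ]
  exact join_isContained_join Embedding.sumInl.isContained
    completeEquipartiteGraph.turanGraph.isContained

end Decomposition

section Minimal

variable {V W : Type*} [Fintype W] {A : SimpleGraph V} {B : SimpleGraph W}

lemma IsContained.ncard_edgeSet_le (h : A ⊑ B) : A.edgeSet.ncard ≤ B.edgeSet.ncard := by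
  obtain ⟨f⟩ := h
  exact Set.ncard_le_ncard_of_injOn (fun e => e.map f)
    (fun e he => by
      induction e with
      | _ a b => exact f.toHom.map_adj he)
    (Sym2.map.injective f.injective).injOn

lemma IsContained.card_le [Fintype V] (h : A ⊑ B) : Fintype.card V ≤ Fintype.card W := by
  obtain ⟨f⟩ := h
  exact Fintype.card_le_of_injective f f.injective

lemma IsContained.symm_of_card [Fintype V] (h : A ⊑ B) (hV : Fintype.card W ≤ Fintype.card V)
    (hE : B.edgeSet.ncard ≤ A.edgeSet.ncard) : B ⊑ A := by
  obtain ⟨f⟩ := h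
  have hf : Function.Bijective f :=
    (Fintype.bijective_iff_injective_and_card f).2 ⟨f.injective,
      (Fintype.card_le_of_injective f f.injective).antisymm hV⟩
  let e : V ≃ W := Equiv.ofBijective f hf
  have hle : A.map e ≤ B := by
    change A.map e.toEmbedding ≤ B
    rw [map_le_iff_le_comap]
    exact fun a b hab => f.toHom.map_adj hab
  have heq : A.map e = B := by
    rw [← edgeSet_inj]
    refine Set.eq_of_subset_of_ncard_le (edgeSet_mono hle) ?_ (Set.toFinite _)
    rw [← ncard_edgeSet_congr (Iso.map e A)]
    exact hE
  rw [← heq]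
  exact (Iso.map e A).symm.isContained

end Minimal

/-- Minimising vertices plus edges gives a minimal graph in the subgraph order, since containment
between finite graphs with equally many vertices and edges is reversible. -/
lemma exists_mem_decompositionFamily {U : Type*} {L : SimpleGraph U} {n : ℕ}
    {M : SimpleGraph (Fin n)} (h : Decomposes L M) :
    ∃ F ∈ decompositionFamily L, F.2 ⊑ M := by
  let f : (Σ n : ℕ, SimpleGraph (Fin n)) → ℕ := fun F => F.1 + F.2.edgeSet.ncard
  obtain ⟨F, ⟨hF, hFM⟩, hmin⟩ := (measure f).wf.has_min
    {F : Σ n : ℕ, SimpleGraph (Fin n) | Decomposes L F.2 ∧ F.2 ⊑ M} ⟨⟨n, M⟩, h, .refl _⟩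
  refine ⟨F, ⟨hF, fun F' hF' hle => ?_⟩, hFM⟩
  have h1 : ¬ (F'.1 + F'.2.edgeSet.ncard < F.1 + F.2.edgeSet.ncard) :=
    hmin F' ⟨hF', hle.trans hFM⟩
  have h2 := IsContained.card_le hle
  have h3 := IsContained.ncard_edgeSet_le hle
  rw [Fintype.card_fin, Fintype.card_fin] at h2
  exact IsContained.symm_of_card hle (by simp; omega) (by omega)

/-- A version of `exists_mem_decompositionFamily` for graphs on arbitrary finite types. -/
lemma exists_mem_decompositionFamily_of_isContained {U W : Type*} [Fintype W]
    {L : SimpleGraph U} {H : SimpleGraph W} {m s : ℕ} (hχ : L.chromaticNumber.toNat - 2 = m)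
    (h : L ⊑ join H (completeEquipartiteGraph m s)) :
    ∃ F ∈ decompositionFamily L, F.2 ⊑ H := by
  let M : SimpleGraph (Fin (Fintype.card W)) := H.comap (Fintype.equivFin W).symm
  let e : M ≃g H := ⟨(Fintype.equivFin W).symm, Iff.rfl⟩
  obtain ⟨F, hF, hFM⟩ := exists_mem_decompositionFamily (decomposes_of_isContained (M := M) hχ
    (h.trans (join_isContained_join e.symm.isContained (.refl _))))
  exact ⟨F, hF, hFM.trans e.isContained⟩

/-! ### The covering family and copies of `L` in joins -/

section Family

variable {U : Type*} [Fintype U] {L : SimpleGraph U} {m : ℕ}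

lemma indepCoverNum_le {V : Type*} {F : SimpleGraph V} {X : Finset V}
    (hc : F.IsVertexCover (X : Set V)) (hi : F.IsIndepSet (X : Set V)) :
    indepCoverNum F ≤ X.card := Nat.sInf_le ⟨X, hc, hi, rfl⟩

/-- A colour class is an independent covering, so the infimum is attained and is not the default `0`
of the empty set. -/
lemma exists_indepCover {V : Type*} [Fintype V] {F : SimpleGraph V} (h : F.IsBipartite) :
    ∃ X : Finset V, F.IsVertexCover (X : Set V) ∧ F.IsIndepSet (X : Set V) ∧
      X.card = indepCoverNum F := by
  refine Nat.sInf_mem (s := {k | ∃ X : Finset V, F.IsVertexCover (X : Set V) ∧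
    F.IsIndepSet (X : Set V) ∧ X.card = k}) ?_
  obtain ⟨c⟩ := h
  refine ⟨_, Finset.univ.filter fun v => c v = 0, fun u v huv => ?_, fun u hu v hv _ huv => ?_, rfl⟩
  · have := c.valid huv
    simp only [coe_filter, mem_univ, true_and, Set.mem_ofPred_eq]
    omega
  · simp only [coe_filter, mem_univ, true_and, Set.mem_ofPred_eq] at hu hv
    exact c.valid huv (hu.trans hv.symm)

lemma isBipartite_of_indepCover {V : Type*} {F : SimpleGraph V} {X : Set V}
    (hc : F.IsVertexCover X) (hi : F.IsIndepSet X) : F.IsBipartite := by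
  refine ⟨Coloring.mk (fun v => if v ∈ X then 0 else 1) fun {u v} huv => ?_⟩
  have h1 := hc huv
  by_cases hu : u ∈ X
  · have hv : v ∉ X := fun hv => hi hu hv huv.ne huv
    simp [hu, hv]
  · have hv : v ∈ X := h1.resolve_left hu
    simp [hu, hv]

lemma familyIndepCoverNum_le {𝓕 : GraphFamily} {F : Σ m : ℕ, SimpleGraph (Fin m)} (hF : F ∈ 𝓕)
    {X : Finset (Fin F.1)} (hc : F.2.IsVertexCover (X : Set (Fin F.1)))
    (hi : F.2.IsIndepSet (X : Set (Fin F.1))) : familyIndepCoverNum 𝓕 ≤ X.card :=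
  le_trans (Nat.sInf_le ⟨F, hF, isBipartite_of_indepCover hc hi, rfl⟩) (indepCoverNum_le hc hi)

lemma exists_indepCover_family {𝓕 : GraphFamily} (h : ∃ F ∈ 𝓕, F.2.IsBipartite) :
    ∃ F ∈ 𝓕, ∃ X : Finset (Fin F.1), F.2.IsVertexCover (X : Set (Fin F.1)) ∧
      F.2.IsIndepSet (X : Set (Fin F.1)) ∧ X.card = familyIndepCoverNum 𝓕 := by
  obtain ⟨F₀, hF₀, hb₀⟩ := h
  obtain ⟨F, hF, hb, hq⟩ := Nat.sInf_mem
    (s := {k | ∃ F ∈ 𝓕, F.2.IsBipartite ∧ indepCoverNum F.2 = k}) ⟨_, F₀, hF₀, hb₀, rfl⟩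
  obtain ⟨X, hc, hi, hX⟩ := exists_indepCover hb
  exact ⟨F, hF, X, hc, hi, hX.trans hq⟩

/-- The empty graph avoids the covering family. -/
lemma familyFree_coveringFamily_bot {𝓕 : GraphFamily} (hq : 0 < familyIndepCoverNum 𝓕) :
    FamilyFree (coveringFamily 𝓕) (⊥ : SimpleGraph (Fin (familyIndepCoverNum 𝓕 - 1))) := by
  intro Q hQ hQle
  unfold coveringFamily at hQ
  split_ifs at hQ with h
  · obtain ⟨F, hF, X, hc, hX, ⟨e⟩⟩ := hQ
    obtain ⟨f⟩ := e.symm.isContained.trans hQle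
    -- A covering that induces no edge would be an independent covering with fewer than `q`
    -- vertices.
    refine absurd (familyIndepCoverNum_le hF hc fun u hu v hv _ huv => ?_) hX.not_ge
    exact f.toHom.map_adj (v := ⟨u, hu⟩) (w := ⟨v, hv⟩) huv
  · obtain rfl := Set.mem_singleton_iff.1 hQ
    have := IsContained.card_le hQle
    simp only [Fintype.card_fin] at this
    omega

/-- Graphs on few vertices avoid the covering family if their joins with complete multipartite
graphs avoid `L`. -/
lemma familyFree_of_free_join (hχ : L.chromaticNumber.toNat - 2 = m) (hm : 0 < m)
    {𝓜 : GraphFamily} (h𝓜 : 𝓜 = decompositionFamily L) (hq : 0 < familyIndepCoverNum 𝓜)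
    {Q : SimpleGraph (Fin (familyIndepCoverNum 𝓜 - 1))}
    (hfree : L.Free (join Q (completeEquipartiteGraph (m + 1) (Fintype.card U)))) :
    FamilyFree (coveringFamily 𝓜) Q := by
  intro B hB hBle
  unfold coveringFamily at hB
  split_ifs at hB with h
  · obtain ⟨F, hF, X, hc, hX, ⟨e⟩⟩ := hB
    obtain ⟨g⟩ := e.symm.isContained.trans hBle
    rw [h𝓜] at hF
    obtain ⟨v, t, ⟨f⟩⟩ := hF.1
    rw [hχ] at f
    -- The covering goes into `Q`. The rest of `F` is independent and forms, with the isolated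
    -- vertices, the new class `0`; the `m` Turán classes are shifted by one.
    let col : ((Fin F.1 ⊕ Fin v) ⊕ Fin t) → Fin (familyIndepCoverNum 𝓜 - 1) ⊕ Fin (m + 1) :=
      Sum.elim (Sum.elim (fun u => if hu : u ∈ (X : Set (Fin F.1)) then .inl (g ⟨u, hu⟩)
        else .inr 0) fun _ => .inr 0) fun y => .inr (Fin.succ ⟨(y : ℕ) % m, Nat.mod_lt _ hm⟩)
    have hinl : ∀ z a, col z = .inl a → ∃ u, ∃ hu : u ∈ (X : Set (Fin F.1)),
        z = .inl (.inl u) ∧ g ⟨u, hu⟩ = a := by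
      rintro ((u | i) | y) a hz
      · by_cases hu : u ∈ (X : Set (Fin F.1))
        · simp only [col, Sum.elim_inl, dif_pos hu, Sum.inl.injEq] at hz
          exact ⟨u, hu, rfl, hz⟩
        · simp only [col, Sum.elim_inl, dif_neg hu, reduceCtorEq] at hz
      · simp [col] at hz
      · simp [col] at hz
    refine hfree (isContained_join_of_coloring (fun x => col (f x)) ?_ ?_ ?_)
    · intro x y a b hxy hx hy
      obtain ⟨u, hu, hxu, rfl⟩ := hinl _ _ hx
      obtain ⟨w, hw, hyw, rfl⟩ := hinl _ _ hy
      refine g.toHom.map_adj (v := ⟨u, hu⟩) (w := ⟨w, hw⟩) ?_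
      have := f.toHom.map_adj hxy
      simpa [hxu, hyw] using this
    · intro x y a hx hy
      obtain ⟨u, hu, hxu, hga⟩ := hinl _ _ hx
      obtain ⟨w, hw, hyw, hgb⟩ := hinl _ _ hy
      have : u = w := by simpa using g.injective (hga.trans hgb.symm)
      subst this
      exact f.injective (hxu.trans hyw.symm)
    · intro x y i hxy hx hy
      have hadj := f.toHom.map_adj hxy
      simp only [Copy.toHom_apply] at hadj
      rcases hfx : f x with (u | a) | a <;> rcases hfy : f y with (w | b) | b <;>
        rw [hfx, hfy] at hadj <;> simp only [hfx, hfy, col, Sum.elim_inl, Sum.elim_inr] at hx hy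
      · have huw : F.2.Adj u w := by simpa using hadj
        rcases hc huw with hu | hw
        · simp [hu] at hx
        · simp [hw] at hy
      · simp at hadj
      · split_ifs at hx
        simp only [Sum.inr.injEq] at hx hy
        rw [← hy] at hx
        exact (Fin.succ_ne_zero _ hx.symm)
      · simp at hadj
      · simp at hadj
      · simp only [Sum.inr.injEq] at hx hy
        rw [← hy] at hx
        exact (Fin.succ_ne_zero _ hx.symm)
      · split_ifs at hy
        simp only [Sum.inr.injEq] at hx hy
        rw [← hy] at hx
        exact (Fin.succ_ne_zero _ hx)
      · simp only [Sum.inr.injEq] at hx hy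
        rw [← hy] at hx
        exact (Fin.succ_ne_zero _ hx)
      · rw [join_adj_inr_inr, turanGraph_adj] at hadj
        simp only [Sum.inr.injEq] at hx hy
        rw [← hy, Fin.succ_inj, Fin.mk.injEq] at hx
        exact hadj hx
  · obtain rfl := Set.mem_singleton_iff.1 hB
    have := IsContained.card_le hBle
    simp only [Fintype.card_fin] at this
    omega

/-- The join of a graph that avoids the covering family with a Turán graph avoids `L`. -/
lemma free_join_of_familyFree (hχ : L.chromaticNumber.toNat - 2 = m)
    {𝓜 : GraphFamily} (h𝓜 : 𝓜 = decompositionFamily L) (hq : 0 < familyIndepCoverNum 𝓜)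
    {Q : SimpleGraph (Fin (familyIndepCoverNum 𝓜 - 1))}
    (hfree : FamilyFree (coveringFamily 𝓜) Q) (n : ℕ) :
    L.Free (join Q (turanGraph n (m + 1))) := by
  rintro ⟨f⟩
  -- `P` consists of the vertices sent to `Q` or to class `0`. The others are coloured by the
  -- remaining `m` classes, so `L[P]` contains a member of `𝓜`. The value of `ψ` for vertices
  -- outside `P` sent to `Q` is a dummy, as there are none.
  let P : Set U := {x | ∀ y, f x = .inr y → (y : ℕ) % (m + 1) = 0}
  let ψ : U → P ⊕ Fin m := fun x => if hx : x ∈ P then .inl ⟨x, hx⟩ else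
    .inr ((f x).elim (fun _ => ⟨0, by
      simp only [P, Set.mem_ofPred_eq, not_forall] at hx
      obtain ⟨y, -, hy⟩ := hx
      have := Nat.mod_lt (y : ℕ) (show 0 < m + 1 by omega)
      generalize (y : ℕ) % (m + 1) = a at *
      omega⟩) fun y : Fin n => ⟨(y : ℕ) % (m + 1) - 1, by
      simp only [P, Set.mem_ofPred_eq, not_forall] at hx
      obtain ⟨y', -, hy'⟩ := hx
      have := Nat.mod_lt (y : ℕ) (show 0 < m + 1 by omega)
      have := Nat.mod_lt (y' : ℕ) (show 0 < m + 1 by omega)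
      generalize (y : ℕ) % (m + 1) = a at *
      generalize (y' : ℕ) % (m + 1) = b at *
      omega⟩)
  have hψ : ∀ x a, ψ x = .inl a → x = a := by
    intro x a h
    by_cases hx : x ∈ P
    · simp only [ψ, dif_pos hx, Sum.inl.injEq] at h
      rw [← h]
    · simp [ψ, hx] at h
  have hψ' : ∀ x i, ψ x = .inr i → ∃ y, f x = .inr y ∧ (y : ℕ) % (m + 1) = i + 1 := by
    intro x i h
    by_cases hx : x ∈ P
    · simp [ψ, hx] at h
    · have hx' := hx
      simp only [P, Set.mem_ofPred_eq, not_forall] at hx'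
      obtain ⟨y, hy, hy0⟩ := hx'
      simp only [ψ, dif_neg hx, hy, Sum.elim_inr, Sum.inr.injEq] at h
      refine ⟨y, hy, ?_⟩
      have := congrArg Fin.val h
      simp only at this
      omega
  have hL : L ⊑ join (L.induce P) (completeEquipartiteGraph m (Fintype.card U)) := by
    refine isContained_join_of_coloring ψ ?_ ?_ ?_
    · intro x y a b hxy hx hy
      rw [hψ x a hx, hψ y b hy] at hxy
      exact hxy
    · intro x y a hx hy
      rw [hψ x a hx, hψ y a hy]
    · intro x y i hxy hx hy
      obtain ⟨a, ha, ha'⟩ := hψ' x i hx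
      obtain ⟨b, hb, hb'⟩ := hψ' y i hy
      have := f.toHom.map_adj hxy
      simp only [Copy.toHom_apply, ha, hb, join_adj_inr_inr, turanGraph_adj] at this
      exact this (ha'.trans hb'.symm)
  obtain ⟨F, hF, ⟨g⟩⟩ := exists_mem_decompositionFamily_of_isContained hχ hL
  rw [← h𝓜] at hF
  let φ : Fin F.1 → _ := fun u => f (g u)
  have hφ : Function.Injective φ := fun a b hab =>
    g.injective (Subtype.ext (f.injective hab))
  have hφadj : ∀ {a b}, F.2.Adj a b → (join Q (turanGraph n (m + 1))).Adj (φ a) (φ b) :=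
    fun {a b} hab => f.toHom.map_adj (g.toHom.map_adj hab)
  -- Class `0` is independent, so the vertices of `F` sent to `Q` cover `F`; there are at most `q -
  -- 1` of them.
  let X : Finset (Fin F.1) := Finset.univ.filter fun u => (φ u).isLeft
  have hXmem : ∀ u, u ∈ (X : Set (Fin F.1)) ↔ (φ u).isLeft := by simp [X]
  have hcover : F.2.IsVertexCover (X : Set (Fin F.1)) := by
    intro u v huv
    by_contra! h
    rw [hXmem, hXmem] at h
    rcases hu : φ u with a | a
    · simp [hu] at h
    rcases hv : φ v with b | b
    · simp [hv] at h
    have h1 := hφadj huv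
    rw [hu, hv, join_adj_inr_inr, turanGraph_adj] at h1
    exact h1 (((g u).2 a hu).trans ((g v).2 b hv).symm)
  have hleft : ∀ u : (X : Set (Fin F.1)), ∃ a, φ u = .inl a := fun u =>
    Sum.isLeft_iff.1 ((hXmem u).1 u.2)
  choose η hη using hleft
  have hηinj : Function.Injective η := fun a b hab =>
    Subtype.ext (hφ (by rw [hη, hη, hab]))
  have hXcard : X.card < familyIndepCoverNum 𝓜 := by
    have h1 := Fintype.card_le_of_injective η hηinj
    rw [Fintype.card_fin] at h1
    have h2 : Fintype.card (X : Set (Fin F.1)) = X.card := Fintype.card_coe _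
    omega
  have hif : ∃ F ∈ 𝓜, F.2.vertexCoverNum < (familyIndepCoverNum 𝓜 : ℕ∞) := by
    refine ⟨F, hF, lt_of_le_of_lt hcover.vertexCoverNum_le ?_⟩
    rw [Set.encard_coe_eq_coe_finsetCard]
    exact_mod_cast hXcard
  let Y : SimpleGraph (Fin (Fintype.card (X : Set (Fin F.1)))) :=
    (F.2.induce (X : Set (Fin F.1))).comap (Fintype.equivFin (X : Set (Fin F.1))).symm
  let e : Y ≃g F.2.induce (X : Set (Fin F.1)) :=
    ⟨(Fintype.equivFin (X : Set (Fin F.1))).symm, Iff.rfl⟩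
  have hYB : (⟨_, Y⟩ : Σ m : ℕ, SimpleGraph (Fin m)) ∈ coveringFamily 𝓜 := by
    unfold coveringFamily
    rw [if_pos hif]
    exact ⟨F, hF, X, hcover, hXcard, ⟨e⟩⟩
  refine hfree _ hYB (e.isContained.trans ⟨⟨⟨η, fun {a b} hab => ?_⟩, hηinj⟩⟩)
  have := hφadj (a := a) (b := b) hab
  rwa [hη, hη, join_adj_inl_inl] at this

end Family

end

section

/-! ### Edge blow-ups -/

section Blowup

variable {V W : Type*} {T : SimpleGraph V} {m : ℕ}

lemma adj_of_mem_edge {e : T.edgeSet} {u v : V} (hu : u ∈ (e : Sym2 V)) (hv : v ∈ (e : Sym2 V))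
    (h : u ≠ v) : T.Adj u v := by
  have h1 := e.2
  rwa [(Sym2.mem_and_mem_iff h).1 ⟨hu, hv⟩, mem_edgeSet] at h1

@[simp] lemma inl_mem_blowupClique {k : ℕ} {e : T.edgeSet} {v : V} :
    .inl v ∈ blowupClique T k e ↔ v ∈ (e : Sym2 V) := by
  simp [blowupClique]

@[simp] lemma inr_mem_blowupClique {k : ℕ} {e e' : T.edgeSet} {i : Fin (k - 2)} :
    .inr (e', i) ∈ blowupClique T k e ↔ e' = e := by
  simp only [blowupClique, Set.mem_ofPred_eq, reduceCtorEq, and_false, exists_false, false_or,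
    Sum.inr.injEq, Prod.mk.injEq, exists_and_left, exists_eq', and_true]

@[simp] lemma edgeBlowup_adj_inl_inl {k : ℕ} {u v : V} :
    (edgeBlowup T k).Adj (.inl u) (.inl v) ↔ T.Adj u v := by
  simp only [edgeBlowup, inl_mem_blowupClique, ne_eq, Sum.inl.injEq]
  exact ⟨fun ⟨hne, e, hu, hv⟩ => adj_of_mem_edge hu hv hne,
    fun h => ⟨h.ne, ⟨s(u, v), h⟩, Sym2.mem_mk_left _ _, Sym2.mem_mk_right _ _⟩⟩

@[simp] lemma edgeBlowup_adj_inl_inr {k : ℕ} {v : V} {e : T.edgeSet} {i : Fin (k - 2)} :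
    (edgeBlowup T k).Adj (.inl v) (.inr (e, i)) ↔ v ∈ (e : Sym2 V) := by
  simp [edgeBlowup]

@[simp] lemma edgeBlowup_adj_inr_inr {k : ℕ} {e e' : T.edgeSet} {i j : Fin (k - 2)} :
    (edgeBlowup T k).Adj (.inr (e, i)) (.inr (e', j)) ↔ e = e' ∧ i ≠ j := by
  simp only [edgeBlowup, inr_mem_blowupClique, ne_eq, Sum.inr.injEq, Prod.mk.injEq]
  constructor
  · rintro ⟨h, e'', rfl, rfl⟩
    exact ⟨rfl, fun hij => h ⟨rfl, hij⟩⟩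
  · rintro ⟨rfl, h⟩
    exact ⟨fun h' => h h'.2, e, rfl, rfl⟩

/-- If a set `S` of vertices meets the clique of an edge in at most one vertex, then no map to
`m` colors is proper outside `S`. -/
lemma exists_pair_of_coloring (e : T.edgeSet) (S : Set (V ⊕ T.edgeSet × Fin (m + 2 - 2)))
    (c : V ⊕ T.edgeSet × Fin (m + 2 - 2) → Fin m)
    (hc : ∀ x y, (edgeBlowup T (m + 2)).Adj x y → x ∉ S → y ∉ S → c x ≠ c y) :
    ∃ x ∈ S, ∃ y ∈ S, x ≠ y ∧ x ∈ blowupClique T (m + 2) e ∧ y ∈ blowupClique T (m + 2) e := by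
  obtain ⟨⟨a, b⟩, hab⟩ : ∃ ab : V × V, (e : Sym2 V) = s(ab.1, ab.2) := by
    rcases e with ⟨⟨a, b⟩, h⟩
    exact ⟨(a, b), rfl⟩
  have hne : a ≠ b := by
    have := e.2
    rw [hab, mem_edgeSet] at this
    exact this.ne
  let κ : Option (Option (Fin m)) → V ⊕ T.edgeSet × Fin (m + 2 - 2) := fun o =>
    o.elim (.inl a) fun o => o.elim (.inl b) fun i => .inr (e, i)
  have hκ : ∀ o, κ o ∈ blowupClique T (m + 2) e := by
    rintro (_ | _ | i)
    · change Sum.inl a ∈ _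
      simp [hab]
    · change Sum.inl b ∈ _
      simp [hab]
    · change Sum.inr _ ∈ _
      simp
  have hinj : Function.Injective κ := by
    rintro (_ | _ | i) (_ | _ | j) h <;> simp [κ, hne, hne.symm] at h ⊢
    exact h
  -- The `m + 2` vertices of the clique take at most `m + 1` values. Two of them outside `S` cannot
  -- agree, so the collision occurs at `none`.
  let g : Option (Option (Fin m)) → Option (Fin m) := fun o =>
    if κ o ∈ S then none else some (c (κ o))
  obtain ⟨o, o', hoo', hg⟩ := Fintype.exists_ne_map_eq_of_card_lt g (by simp)
  have hne' := hinj.ne hoo'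
  by_cases h : κ o ∈ S <;> by_cases h' : κ o' ∈ S <;> simp [g, h, h'] at hg
  · exact ⟨_, h, _, h', hne', hκ _, hκ _⟩
  · exact absurd hg (hc _ _ ⟨hne', e, hκ _, hκ _⟩ h h')

/-- The vertices of the edge blow-up that are in `C`, together with the first new vertex of each
clique and the second new vertex of the cliques that avoid `C`. -/
def splitSet (T : SimpleGraph V) (m : ℕ) (C : Set V) : Set (V ⊕ T.edgeSet × Fin (m + 2 - 2)) :=
  {x | x.elim (fun v => v ∈ C) fun y =>
    (y.2 : ℕ) = 0 ∨ (y.2 : ℕ) = 1 ∧ ∀ v ∈ (y.1 : Sym2 V), v ∉ C}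

lemma inl_mem_splitSet {C : Set V} {v : V} : .inl v ∈ splitSet T m C ↔ v ∈ C := Iff.rfl

lemma inr_mem_splitSet {C : Set V} {e : T.edgeSet} {i : Fin (m + 2 - 2)} :
    .inr (e, i) ∈ splitSet T m C ↔
      (i : ℕ) = 0 ∨ (i : ℕ) = 1 ∧ ∀ v ∈ (e : Sym2 V), v ∉ C := Iff.rfl

/-- Copies of an edge blow-up in a join: the vertices in `C` and one or two new vertices of each
clique are sent to `H`, the others are colored with `m` colors. -/
lemma edgeBlowup_isContained_join [Fintype V] {H : SimpleGraph W} (hm : 2 ≤ m) {A C : Set V}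
    (hA : ∀ u v, T.Adj u v → (u ∈ A ↔ v ∉ A)) (hC : T.IsIndepSet C)
    (φ : V ⊕ T.edgeSet × Fin (m + 2 - 2) → W)
    (hφ : Set.InjOn φ (splitSet T m C))
    (h1 : ∀ v ∈ C, ∀ (e : T.edgeSet) (i : Fin (m + 2 - 2)), v ∈ (e : Sym2 V) → (i : ℕ) = 0 →
      H.Adj (φ (.inl v)) (φ (.inr (e, i))))
    (h2 : ∀ (e : T.edgeSet) (i j : Fin (m + 2 - 2)), (∀ v ∈ (e : Sym2 V), v ∉ C) → (i : ℕ) = 0 →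
      (j : ℕ) = 1 → H.Adj (φ (.inr (e, i))) (φ (.inr (e, j)))) :
    edgeBlowup T (m + 2) ⊑ join H (completeEquipartiteGraph m
      (Fintype.card (V ⊕ T.edgeSet × Fin (m + 2 - 2)))) := by
  set S := splitSet T m C with hS
  -- Each clique has exactly two vertices in `S`. Ends outside `C` get colour `0` or `1` by the
  -- bipartition, new vertices their index. Only if an end in `A` belongs to `C` does the second new
  -- vertex switch to colour `0`, which that end has vacated, because the other end has colour `1`.
  let c : V ⊕ T.edgeSet × Fin (m + 2 - 2) → Fin m :=
    Sum.elim (fun v => if v ∈ A then ⟨0, by omega⟩ else ⟨1, by omega⟩) fun y =>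
      if (y.2 : ℕ) = 1 ∧ ∃ v ∈ (y.1 : Sym2 V), v ∈ C ∧ v ∈ A then ⟨0, by omega⟩
      else ⟨y.2, y.2.isLt⟩
  have hcl : ∀ v, (c (.inl v) : ℕ) = if v ∈ A then 0 else 1 := by
    intro v
    by_cases h : v ∈ A <;> simp [c, h]
  have hcr : ∀ e i, (c (.inr (e, i)) : ℕ) =
      if (i : ℕ) = 1 ∧ ∃ v ∈ (e : Sym2 V), v ∈ C ∧ v ∈ A then 0 else (i : ℕ) := by
    intro e i
    by_cases h : (i : ℕ) = 1 ∧ ∃ v ∈ (e : Sym2 V), v ∈ C ∧ v ∈ A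
    · simp only [c, Sum.elim_inr, if_pos h]
    · simp only [c, Sum.elim_inr, if_neg h]
  have hmix : ∀ (v : V) (e : T.edgeSet) (i : Fin (m + 2 - 2)), v ∈ (e : Sym2 V) → .inl v ∉ S → .inr (e, i) ∉ S →
      c (.inl v) ≠ c (.inr (e, i)) := by
    intro v e i hv hvS hiS heq
    rw [hS, inl_mem_splitSet] at hvS
    rw [hS, inr_mem_splitSet] at hiS
    push Not at hiS
    have heq' := congrArg Fin.val heq
    rw [hcl, hcr] at heq'
    by_cases hi : (i : ℕ) = 1
    · obtain ⟨w, hw, hwC⟩ := hiS.2 hi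
      have hvw : T.Adj v w := adj_of_mem_edge hv hw fun h => hvS (h ▸ hwC)
      have hiff := hA v w hvw
      by_cases hwA : w ∈ A
      · rw [if_neg (fun h => hiff.1 h hwA), if_pos ⟨hi, w, hw, hwC, hwA⟩] at heq'
        omega
      · rw [if_pos (hiff.2 hwA), if_neg] at heq'
        · omega
        · rintro ⟨-, u, hu, huC, huA⟩
          have huw : u ≠ w := fun h => hwA (h ▸ huA)
          exact hC huC hwC huw (adj_of_mem_edge hu hw huw)
    · simp only [hi, false_and, if_false] at heq'
      split_ifs at heq' <;> omega
  have hcol : ∀ x y, (edgeBlowup T (m + 2)).Adj x y → x ∉ S → y ∉ S → c x ≠ c y := by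
    rintro (u | ⟨e, i⟩) (v | ⟨e', j⟩) hxy hx hy
    · rw [edgeBlowup_adj_inl_inl] at hxy
      intro heq
      have heq' := congrArg Fin.val heq
      rw [hcl, hcl] at heq'
      have := hA u v hxy
      by_cases hu : u ∈ A <;> by_cases hv : v ∈ A <;> simp [hu, hv] at heq' this
    · exact hmix u e' j (edgeBlowup_adj_inl_inr.1 hxy) hx hy
    · exact (hmix v e i (edgeBlowup_adj_inl_inr.1 hxy.symm) hy hx).symm
    · obtain ⟨rfl, hij⟩ := edgeBlowup_adj_inr_inr.1 hxy
      intro heq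
      have heq' := congrArg Fin.val heq
      rw [hcr, hcr] at heq'
      rw [hS, inr_mem_splitSet] at hx hy
      have hij' : (i : ℕ) ≠ j := fun h => hij (Fin.ext h)
      split_ifs at heq' <;> omega
  have hadj : ∀ x y, (edgeBlowup T (m + 2)).Adj x y → x ∈ S → y ∈ S → H.Adj (φ x) (φ y) := by
    have hmix' : ∀ (v : V) (e : T.edgeSet) (i : Fin (m + 2 - 2)), v ∈ (e : Sym2 V) → .inl v ∈ S → .inr (e, i) ∈ S →
        H.Adj (φ (.inl v)) (φ (.inr (e, i))) := fun v e i hv hvS hiS =>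
      h1 v hvS e i hv ((inr_mem_splitSet.1 hiS).resolve_right fun h => h.2 v hv hvS)
    rintro (u | ⟨e, i⟩) (v | ⟨e', j⟩) hxy hx hy
    · rw [edgeBlowup_adj_inl_inl] at hxy
      exact absurd hxy (hC hx hy hxy.ne)
    · exact hmix' u e' j (edgeBlowup_adj_inl_inr.1 hxy) hx hy
    · exact (hmix' v e i (edgeBlowup_adj_inl_inr.1 hxy.symm) hy hx).symm
    · obtain ⟨rfl, hij⟩ := edgeBlowup_adj_inr_inr.1 hxy
      have hij' : (i : ℕ) ≠ j := fun h => hij (Fin.ext h)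
      rw [hS, inr_mem_splitSet] at hx hy
      rcases hx with hi | ⟨hi, he⟩
      · rcases hy with hj | ⟨hj, he⟩
        · omega
        · exact h2 e i j he hi hj
      · rcases hy with hj | ⟨hj, -⟩
        · exact (h2 e j i he hj hi).symm
        · omega
  let ψ : V ⊕ T.edgeSet × Fin (m + 2 - 2) → W ⊕ Fin m := fun x =>
    if x ∈ S then .inl (φ x) else .inr (c x)
  have hψ : ∀ x a, ψ x = .inl a → x ∈ S ∧ φ x = a := by
    intro x a h
    by_cases hx : x ∈ S <;> simp [ψ, hx] at h
    exact ⟨hx, h⟩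
  have hψ' : ∀ x i, ψ x = .inr i → x ∉ S ∧ c x = i := by
    intro x a h
    by_cases hx : x ∈ S <;> simp [ψ, hx] at h
    exact ⟨hx, h⟩
  refine isContained_join_of_coloring ψ ?_ ?_ ?_
  · intro x y a b hxy hx hy
    obtain ⟨hxS, rfl⟩ := hψ x a hx
    obtain ⟨hyS, rfl⟩ := hψ y b hy
    exact hadj x y hxy hxS hyS
  · intro x y a hx hy
    obtain ⟨hx, hxa⟩ := hψ x a hx
    obtain ⟨hy, hya⟩ := hψ y a hy
    exact hφ hx hy (hxa.trans hya.symm)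
  · intro x y i hxy hx hy
    obtain ⟨hx, hxi⟩ := hψ' x i hx
    obtain ⟨hy, hyi⟩ := hψ' y i hy
    exact hcol x y hxy hx hy (hxi.trans hyi.symm)

/-- For `C = ∅` each clique sends just its first two new vertices to the matching, which is why `m ≥
2` is needed. The values on `V` only make the map total. -/
lemma edgeBlowup_isContained_join_matching [Fintype V] (hm : 2 ≤ m) {A : Set V}
    (hA : ∀ u v, T.Adj u v → (u ∈ A ↔ v ∉ A)) :
    edgeBlowup T (m + 2) ⊑ join (starForest (Fintype.card (V ⊕ T.edgeSet)) 1)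
      (completeEquipartiteGraph m (Fintype.card (V ⊕ T.edgeSet × Fin (m + 2 - 2)))) := by
  let ι := Fintype.equivFin (V ⊕ T.edgeSet)
  refine edgeBlowup_isContained_join hm hA (C := ∅) (by simp [IsIndepSet])
    (Sum.elim (fun v => (ι (.inl v), none)) fun y =>
      (ι (.inr y.1), if (y.2 : ℕ) = 0 then none else some 0)) ?_ (by simp) ?_
  · rintro (u | ⟨e, i⟩) hx (v | ⟨e', j⟩) hy hxy
    · simp [inl_mem_splitSet] at hx
    · simp [inl_mem_splitSet] at hx
    · simp [inl_mem_splitSet] at hy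
    · rw [inr_mem_splitSet] at hx hy
      simp only [Sum.elim_inr, Prod.mk.injEq, EmbeddingLike.apply_eq_iff_eq, Sum.inr.injEq] at hxy
      obtain ⟨rfl, h⟩ := hxy
      have : (i : ℕ) = j := by
        split_ifs at h <;> omega
      rw [Fin.ext this]
  · intro e i j _ hi hj
    simp [starForest, hi, hj]

end Blowup

end

/-! ### Chromatic number, independent sets of the tree and star forests -/

section

section BlowupFamily

variable {V W : Type*} {T : SimpleGraph V} {m : ℕ}

lemma starForest_isBipartite (r s : ℕ) : (starForest r s).IsBipartite := by
  refine ⟨Coloring.mk (fun x => if x.2 = none then 0 else 1) fun {x y} h => ?_⟩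
  rcases h.2 with h | h <;> simp [h.1, h.2]

/-- The matching embedding gives `2 + m` colours. With `m + 1` colours, the last colour class would
contain two vertices of one clique by `exists_pair_of_coloring`. -/
lemma chromaticNumber_edgeBlowup [Fintype V] (hm : 2 ≤ m) {A : Set V}
    (hA : ∀ u v, T.Adj u v → (u ∈ A ↔ v ∉ A)) (e : T.edgeSet) :
    (edgeBlowup T (m + 2)).chromaticNumber = (m + 2 : ℕ) := by
  refine le_antisymm ?_ ?_
  · rw [chromaticNumber_le_iff_colorable]
    obtain ⟨f⟩ := edgeBlowup_isContained_join_matching hm hA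
    obtain ⟨b⟩ := starForest_isBipartite (Fintype.card (V ⊕ T.edgeSet)) 1
    let c : (edgeBlowup T (m + 2)).Coloring (Fin 2 ⊕ Fin m) :=
      Coloring.mk (fun x => Sum.map b Prod.fst (f x)) fun {x y} hxy => by
        have hadj : (join _ _).Adj (f x) (f y) := f.toHom.map_adj hxy
        rcases hx : f x with u | u <;> rcases hy : f y with w | w <;> rw [hx, hy] at hadj <;>
          simp only [Sum.map_inl, Sum.map_inr, ne_eq, reduceCtorEq, not_false_eq_true,
            Sum.inl.injEq, Sum.inr.injEq]
        · exact b.valid (join_adj_inl_inl.1 hadj)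
        · exact join_adj_inr_inr.1 hadj
    have := c.colorable
    rwa [Fintype.card_sum, Fintype.card_fin, Fintype.card_fin, Nat.add_comm 2 m] at this
  · by_contra! h
    have h' : (edgeBlowup T (m + 2)).chromaticNumber ≤ (m + 1 : ℕ) := by
      rw [show ((m + 2 : ℕ) : ℕ∞) = ((m + 1 : ℕ) : ℕ∞) + 1 by push_cast; ring] at h
      exact Order.le_of_lt_add_one h
    obtain ⟨c⟩ := chromaticNumber_le_iff_colorable.1 h'
    obtain ⟨x, hx, y, hy, hne, hxe, hye⟩ := exists_pair_of_coloring e {x | ¬ (c x : ℕ) < m}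
      (fun x => if h : (c x : ℕ) < m then ⟨c x, h⟩ else ⟨0, by omega⟩) fun x y hxy hx hy heq => by
        simp only [Set.mem_ofPred_eq, not_not] at hx hy
        simp only [dif_pos hx, dif_pos hy, Fin.mk.injEq] at heq
        exact c.valid hxy (Fin.ext heq)
    refine c.valid (show (edgeBlowup T (m + 2)).Adj x y from ⟨hne, e, hxe, hye⟩) (Fin.ext ?_)
    simp only [Set.mem_ofPred_eq] at hx hy
    omega

/-- The edges without an end in `C`. -/
noncomputable def uncovered [Fintype V] (T : SimpleGraph V) (C : Finset V) : Finset T.edgeSet :=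
  Finset.univ.filter fun e => ∀ v ∈ (e : Sym2 V), v ∉ C

lemma mem_uncovered [Fintype V] {C : Finset V} {e : T.edgeSet} :
    e ∈ uncovered T C ↔ ∀ v ∈ (e : Sym2 V), v ∉ C := by
  simp [uncovered]

/-- An independent covering `X` of a graph `F` whose join with a Turán graph contains the edge
blow-up of `T` yields an independent set of `T` that leaves few edges uncovered. -/
lemma exists_indepSet_of_copy [Fintype V] (hm : 0 < m) {F : SimpleGraph W} {X : Finset W}
    (hc : F.IsVertexCover (X : Set W)) (hi : F.IsIndepSet (X : Set W)) {v t : ℕ}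
    (h : edgeBlowup T (m + 2) ⊑ join (F ⊕g (⊥ : SimpleGraph (Fin v))) (turanGraph t m)) :
    ∃ C : Finset V, T.IsIndepSet (C : Set V) ∧ C.card + (uncovered T C).card ≤ X.card := by
  obtain ⟨f⟩ := h
  have hadj : ∀ {x y}, (edgeBlowup T (m + 2)).Adj x y →
      (join (F ⊕g (⊥ : SimpleGraph (Fin v))) (turanGraph t m)).Adj (f x) (f y) :=
    fun {x y} h => f.toHom.map_adj h
  let P : V ⊕ T.edgeSet × Fin (m + 2 - 2) → Prop := fun x => ∃ w ∈ X, f x = .inl (.inl w)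
  -- The Turán graph takes at most `m` vertices of the clique, so two adjacent ones land in `F`, and
  -- `X` covers that edge.
  have hP : ∀ e : T.edgeSet, ∃ x ∈ blowupClique T (m + 2) e, P x := by
    intro e
    obtain ⟨x, hx, y, hy, hne, hxe, hye⟩ := exists_pair_of_coloring e {x | (f x).isLeft}
      (fun x => (f x).elim (fun _ => ⟨0, hm⟩) fun y : Fin t => ⟨(y : ℕ) % m, Nat.mod_lt _ hm⟩)
      fun x y hxy hx hy heq => by
        have h1 := hadj hxy
        rcases hx' : f x with a | a
        · simp [hx'] at hx
        rcases hy' : f y with b | b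
        · simp [hy'] at hy
        rw [hx', hy', join_adj_inr_inr, turanGraph_adj] at h1
        simp only [hx', hy', Sum.elim_inr, Fin.mk.injEq] at heq
        exact h1 heq
    have h1 := hadj (show (edgeBlowup T (m + 2)).Adj x y from ⟨hne, e, hxe, hye⟩)
    obtain ⟨a, ha⟩ := Sum.isLeft_iff.1 hx
    obtain ⟨b, hb⟩ := Sum.isLeft_iff.1 hy
    rw [ha, hb, join_adj_inl_inl] at h1
    rcases a with a | a <;> rcases b with b | b <;> simp at h1
    rcases hc h1 with haX | hbX
    · exact ⟨x, hxe, a, haX, ha⟩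
    · exact ⟨y, hye, b, hbX, hb⟩
  let C : Finset V := Finset.univ.filter fun v => P (.inl v)
  have hC : ∀ v, v ∈ C ↔ P (.inl v) := fun v => by simp [C]
  -- Each vertex of `C` claims its own image in `X`; an uncovered edge has no end in `C` and claims
  -- the image of a new vertex of its clique.
  have hg : ∀ j ∈ C.disjSum (uncovered T C), ∃ w ∈ X, ∃ x, f x = .inl (.inl w) ∧
      Sum.map id Prod.fst x = j := by
    rintro (v | e) hj
    · rw [Finset.inl_mem_disjSum, hC] at hj
      obtain ⟨w, hw, hfw⟩ := hj
      exact ⟨w, hw, .inl v, hfw, rfl⟩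
    · rw [Finset.inr_mem_disjSum, mem_uncovered] at hj
      obtain ⟨x, hx, w, hw, hfw⟩ := hP e
      rcases x with u | ⟨e', i⟩
      · exact absurd ((hC u).2 ⟨w, hw, hfw⟩) (hj u (inl_mem_blowupClique.1 hx))
      · obtain rfl := inr_mem_blowupClique.1 hx
        exact ⟨w, hw, _, hfw, rfl⟩
  choose g hgX hg using hg
  refine ⟨C, ?_, ?_⟩
  · intro u hu v hv _ huv
    obtain ⟨a, ha, hfa⟩ := (hC u).1 hu
    obtain ⟨b, hb, hfb⟩ := (hC v).1 hv
    have h1 := hadj (edgeBlowup_adj_inl_inl.2 huv)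
    rw [hfa, hfb, join_adj_inl_inl] at h1
    have h2 : F.Adj a b := by simpa using h1
    exact hi ha hb h2.ne h2
  · rw [← Finset.card_disjSum, ← Finset.card_attach]
    refine Finset.card_le_card_of_injOn (fun j => g j.1 j.2) (fun j _ => hgX _ _)
      fun j _ j' _ hjj' => Subtype.ext ?_
    obtain ⟨x, hx, hxj⟩ := hg j.1 j.2
    obtain ⟨y, hy, hyj⟩ := hg j'.1 j'.2
    rw [show g j.1 j.2 = g j'.1 j'.2 from hjj', ← hy] at hx
    rw [← hxj, ← hyj, f.injective hx]

lemma mem_iff_notMem_of_adj {A B : Set V} (hAB : T.IsBipartiteWith A B) {u v : V}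
    (huv : T.Adj u v) : u ∈ A ↔ v ∉ A := by
  rcases hAB.mem_of_adj huv with ⟨hu, hv⟩ | ⟨hu, hv⟩
  · exact iff_of_true hu fun h => Set.disjoint_left.1 hAB.disjoint h hv
  · exact iff_of_false (fun h => Set.disjoint_left.1 hAB.disjoint h hu) (not_not.2 hv)

lemma exists_ncard_neighborSet_eq_one {A : Set V} (hδ : minDegreeOn T A = 1) :
    ∃ v ∈ A, (T.neighborSet v).ncard = 1 := by
  have hmem := Nat.sInf_mem (s := (fun x => (T.neighborSet x).ncard) '' A) (by
    by_contra h
    rw [Set.not_nonempty_iff_eq_empty] at h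
    simp [minDegreeOn, h] at hδ)
  rwa [show sInf _ = 1 from hδ] at hmem

/-- The index set attached to an independent set of a tree can be chosen to contain a star with a
single edge. -/
lemma exists_indepSet_special [Fintype V] (hT : T.IsTree) {A B : Set V}
    (hAB : T.IsBipartiteWith A B) (hcover : A ∪ B = Set.univ) (hcard : A.ncard ≤ B.ncard)
    (hδ : minDegreeOn T A = 1) {q : ℕ} {C : Finset V} (hC : T.IsIndepSet (C : Set V))
    (hq : C.card + (uncovered T C).card ≤ q) :
    ∃ C : Finset V, T.IsIndepSet (C : Set V) ∧ C.card + (uncovered T C).card ≤ q ∧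
      ((uncovered T C).Nonempty ∨ ∃ v ∈ C, ∀ e e' : T.edgeSet, v ∈ (e : Sym2 V) →
        v ∈ (e' : Sym2 V) → e = e') := by
  by_cases hne : (uncovered T C).Nonempty
  · exact ⟨C, hC, hq, .inl hne⟩
  rw [Finset.not_nonempty_iff_eq_empty] at hne
  have hB : ∀ v, v ∈ B ↔ v ∉ A := fun v =>
    ⟨fun hv hA => Set.disjoint_left.1 hAB.disjoint hA hv, fun hv =>
      ((hcover ▸ Set.mem_univ v : v ∈ A ∪ B)).resolve_left hv⟩
  have hA : ∀ u v, T.Adj u v → (u ∈ A ↔ v ∉ A) := fun u v => mem_iff_notMem_of_adj hAB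
  have hC' : ∀ u v, T.Adj u v → (u ∈ C ↔ v ∉ C) := fun u v huv => by
    refine ⟨fun hu hv => hC hu hv huv.ne huv, fun hv => ?_⟩
    by_contra hu
    have : (⟨s(u, v), huv⟩ : T.edgeSet) ∈ uncovered T C := by
      rw [mem_uncovered]
      intro w hw
      rcases Sym2.mem_iff.1 hw with rfl | rfl <;> assumption
    simp [hne] at this
  -- If `C` meets every edge, membership in `C` and in `A` both flip along each edge. By
  -- connectivity `C` is `A` or `B`.
  have hwalk : ∀ {u v} (_ : T.Walk u v), ((u ∈ C ↔ u ∈ A) ↔ (v ∈ C ↔ v ∈ A)) := by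
    intro u v p
    induction p with
    | nil => rfl
    | cons h _ ih =>
      rw [← ih]
      have h1 := hA _ _ h
      have h2 := hC' _ _ h
      tauto
  have hAC : A.ncard ≤ C.card := by
    obtain ⟨r⟩ := hT.connected.nonempty
    rw [← Set.ncard_coe_finset]
    by_cases hr : r ∈ C ↔ r ∈ A
    · refine (congrArg Set.ncard (Set.ext fun v => ?_)).le
      obtain ⟨p⟩ := hT.connected.preconnected r v
      exact ((hwalk p).1 hr).symm
    · refine hcard.trans (congrArg Set.ncard (Set.ext fun v => ?_)).le
      obtain ⟨p⟩ := hT.connected.preconnected r v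
      have := (hwalk p).not.1 hr
      rw [hB, Finset.mem_coe]
      tauto
  obtain ⟨v, hv, hdeg⟩ := exists_ncard_neighborSet_eq_one hδ
  obtain ⟨w, hw⟩ := Set.ncard_eq_one.1 hdeg
  refine ⟨A.toFinset, ?_, ?_, .inr ⟨v, by simpa using hv, ?_⟩⟩
  · intro x hx y hy _ hxy
    rw [Set.coe_toFinset] at hx hy
    exact (hA x y hxy).1 hx hy
  · have h0 : uncovered T A.toFinset = ∅ := by
      rw [Finset.eq_empty_iff_forall_notMem]
      rintro ⟨⟨a, b⟩, hab⟩ he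
      rw [mem_uncovered] at he
      have h1 := he a (Sym2.mem_mk_left _ _)
      have h2 := he b (Sym2.mem_mk_right _ _)
      rw [Set.mem_toFinset] at h1 h2
      exact h1 ((hA a b hab).2 h2)
    rw [h0, Finset.card_empty, ← Set.ncard_eq_toFinset_card']
    omega
  · have key : ∀ e : T.edgeSet, v ∈ (e : Sym2 V) → (e : Sym2 V) = s(v, w) := by
      rintro ⟨e, he⟩ hve
      obtain ⟨x, rfl⟩ := Sym2.mem_iff_exists.1 hve
      have : x ∈ T.neighborSet v := he
      rw [hw, Set.mem_singleton_iff] at this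
      exact congrArg (fun y => s(v, y)) this
    exact fun e e' he he' => Subtype.ext ((key e he).trans (key e' he').symm)

/-- An independent set of `T` for which one of the stars can be chosen to have a single edge yields
a copy of the edge blow-up. -/
lemma edgeBlowup_isContained_join_starForest [Fintype V] (hm : 2 ≤ m) {A : Set V}
    (hA : ∀ u v, T.Adj u v → (u ∈ A ↔ v ∉ A)) {C : Finset V} (hC : T.IsIndepSet (C : Set V))
    {r : ℕ} (hr : C.card + (uncovered T C).card ≤ r + 1)
    (hsp : (uncovered T C).Nonempty ∨ ∃ v ∈ C, ∀ e e' : T.edgeSet, v ∈ (e : Sym2 V) →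
        v ∈ (e' : Sym2 V) → e = e') :
    edgeBlowup T (m + 2) ⊑ join (starForest r
        (Fintype.card (V ⊕ T.edgeSet × Fin (m + 2 - 2))) ⊕g (⊤ : SimpleGraph (Fin 2)))
      (completeEquipartiteGraph m (Fintype.card (V ⊕ T.edgeSet × Fin (m + 2 - 2)))) := by
  set s := Fintype.card (V ⊕ T.edgeSet × Fin (m + 2 - 2)) with hs
  -- `J` indexes the stars: `v ∈ C` with the first new vertices of the edges at `v` as leaves, or an
  -- uncovered edge with its first two new vertices. `sid e` is the star to which `e` contributes a
  -- leaf.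
  let J : Finset (V ⊕ T.edgeSet) := C.disjSum (uncovered T C)
  have hJ : J.card ≤ r + 1 := by rwa [Finset.card_disjSum]
  have hsid : ∀ e : T.edgeSet, ∃ j ∈ J, (∀ v ∈ C, v ∈ (e : Sym2 V) → j = .inl v) ∧
      ((∀ v ∈ (e : Sym2 V), v ∉ C) → j = .inr e) ∧ (∀ v, j = .inl v → v ∈ (e : Sym2 V)) ∧
      ∀ e', j = .inr e' → e = e' := by
    intro e
    by_cases he : ∃ v ∈ (e : Sym2 V), v ∈ C
    · obtain ⟨v, hv, hvC⟩ := he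
      refine ⟨.inl v, by simpa [J] using hvC, fun w hw hwe => ?_, fun h => absurd hvC (h v hv),
        fun w hw => ?_, fun e' h => by simp at h⟩
      · by_contra hne
        have hne' : v ≠ w := fun h => hne (congrArg _ h)
        exact hC hvC hw hne' (adj_of_mem_edge hv hwe hne')
      · rwa [← Sum.inl_injective hw]
    · push Not at he
      exact ⟨.inr e, by simpa [J, mem_uncovered] using he, fun v hv hve => absurd hv (he v hve),
        fun _ => rfl, fun v h => by simp at h, fun e' h => Sum.inr_injective h⟩
  choose sid hsidJ hsidC hsidE hsidl hsidr using hsid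
  obtain ⟨j₀, hj₀, hj₀'⟩ : ∃ j₀ ∈ J, ∀ e e', sid e = j₀ → sid e' = j₀ → e = e' := by
    rcases hsp with ⟨e, he⟩ | ⟨v, hv, hve⟩
    · exact ⟨.inr e, by simpa [J] using he, fun e₁ e₂ h₁ h₂ =>
        (hsidr e₁ e h₁).trans (hsidr e₂ e h₂).symm⟩
    · exact ⟨.inl v, by simpa [J] using hv, fun e₁ e₂ h₁ h₂ =>
        hve e₁ e₂ (hsidl e₁ v h₁) (hsidl e₂ v h₂)⟩
  -- The star `j₀` has at most one edge and becomes the extra edge, encoded by `none`; the others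
  -- fit into the `r` stars. Values outside `J` are irrelevant.
  obtain ⟨idx, hidx, hidx₀⟩ : ∃ idx : V ⊕ T.edgeSet → Option (Fin r),
      Set.InjOn idx J ∧ idx j₀ = none := by
    have hcard : Fintype.card (J.erase j₀) ≤ Fintype.card (Fin r) := by
      rw [Fintype.card_coe, Finset.card_erase_of_mem hj₀, Fintype.card_fin]
      omega
    obtain ⟨g⟩ := Function.Embedding.nonempty_of_card_le hcard
    refine ⟨fun j => if h : j ∈ J.erase j₀ then some (g ⟨j, h⟩) else none, ?_, by simp⟩
    intro a ha b hb hab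
    have hmem : ∀ j ∈ (J : Set (V ⊕ T.edgeSet)), j ≠ j₀ → j ∈ J.erase j₀ := fun j hj h =>
      Finset.mem_erase.2 ⟨h, hj⟩
    by_cases ha0 : a = j₀ <;> by_cases hb0 : b = j₀
    · rw [ha0, hb0]
    · subst ha0
      simp only [Finset.mem_erase, ne_eq, not_true_eq_false, false_and, dite_false] at hab
      rw [dif_pos (Finset.mem_erase.1 (hmem b hb hb0))] at hab
      simp at hab
    · subst hb0
      simp only [Finset.mem_erase, ne_eq, not_true_eq_false, false_and, dite_false] at hab
      rw [dif_pos (Finset.mem_erase.1 (hmem a ha ha0))] at hab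
      simp at hab
    · simp only [dif_pos (hmem a ha ha0), dif_pos (hmem b hb hb0), Option.some.injEq] at hab
      simpa using g.injective hab
  have hm0 : 0 < m + 2 - 2 := by omega
  let ε : T.edgeSet → Fin s := fun e => Fintype.equivFin _ (.inr (e, ⟨0, hm0⟩))
  have hε : Function.Injective ε := fun e e' h => by simpa [ε] using h
  let center : V ⊕ T.edgeSet → (Fin r × Option (Fin s)) ⊕ Fin 2 := fun j =>
    (idx j).elim (.inr 0) fun a => .inl (a, none)
  let leaf : V ⊕ T.edgeSet → T.edgeSet → (Fin r × Option (Fin s)) ⊕ Fin 2 := fun j e =>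
    (idx j).elim (.inr 1) fun a => .inl (a, some (ε e))
  have hadj : ∀ j e, (starForest r s ⊕g (⊤ : SimpleGraph (Fin 2))).Adj (center j) (leaf j e) := by
    intro j e
    rcases h : idx j with _ | a <;> simp [center, leaf, h, starForest]
  have hcc : ∀ j ∈ J, ∀ j' ∈ J, center j = center j' → j = j' := by
    intro j hj j' hj' h
    refine hidx hj hj' ?_
    rcases h1 : idx j with _ | a <;> rcases h2 : idx j' with _ | b <;>
      simp [center, h1, h2] at h ⊢
    exact h
  have hcl : ∀ j j' e, center j ≠ leaf j' e := by
    intro j j' e h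
    rcases h1 : idx j with _ | a <;> rcases h2 : idx j' with _ | b <;>
      simp [center, leaf, h1, h2] at h
  have hll : ∀ e e', leaf (sid e) e = leaf (sid e') e' → e = e' := by
    intro e e' h
    have hnone : ∀ e, idx (sid e) = none → sid e = j₀ := fun e he =>
      hidx (hsidJ e) hj₀ (he.trans hidx₀.symm)
    rcases h1 : idx (sid e) with _ | a <;> rcases h2 : idx (sid e') with _ | b <;>
      simp [leaf, h1, h2] at h
    · exact hj₀' e e' (hnone e h1) (hnone e' h2)
    · exact hε h.2
  refine edgeBlowup_isContained_join hm hA hC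
    (Sum.elim (fun v => center (.inl v)) fun y =>
      if (y.2 : ℕ) = 0 then leaf (sid y.1) y.1 else center (.inr y.1)) ?_ ?_ ?_
  · have hinl : ∀ v, .inl v ∈ splitSet T m C → .inl v ∈ J := fun v hv => by
      rw [inl_mem_splitSet] at hv
      simpa [J] using hv
    have hinr : ∀ (e : T.edgeSet) (i : Fin (m + 2 - 2)), .inr (e, i) ∈ splitSet T m C →
        (i : ℕ) ≠ 0 → (i : ℕ) = 1 ∧ .inr e ∈ J := fun e i hi h0 => by
      rw [inr_mem_splitSet] at hi
      have := hi.resolve_left h0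
      exact ⟨this.1, by simpa [J, mem_uncovered] using this.2⟩
    have hmix : ∀ (v : V) (e : T.edgeSet) (i : Fin (m + 2 - 2)), .inl v ∈ splitSet T m C →
        .inr (e, i) ∈ splitSet T m C → center (.inl v) ≠
          if (i : ℕ) = 0 then leaf (sid e) e else center (.inr e) := by
      intro v e i hv hi
      split_ifs with h0
      · exact hcl _ _ _
      · exact fun h => by simpa using hcc _ (hinl v hv) _ (hinr e i hi h0).2 h
    rintro (u | ⟨e, i⟩) hx (v | ⟨e', j⟩) hy hxy
    · exact congrArg _ (Sum.inl_injective (hcc _ (hinl u hx) _ (hinl v hy) hxy))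
    · exact absurd hxy (hmix u e' j hx hy)
    · exact absurd hxy.symm (hmix v e i hy hx)
    · simp only [Sum.elim_inr] at hxy
      split_ifs at hxy with hi hj hj
      · rw [hll e e' hxy, Fin.ext (hi.trans hj.symm)]
      · exact absurd hxy.symm (hcl _ _ _)
      · exact absurd hxy (hcl _ _ _)
      · have hi' := hinr e i hx hi
        have hj' := hinr e' j hy hj
        rw [Sum.inr_injective (hcc _ hi'.2 _ hj'.2 hxy), Fin.ext (hi'.1.trans hj'.1.symm)]
  · intro v hv e i hve hi
    simp only [Sum.elim_inl, Sum.elim_inr, hi, if_true, hsidC e v hv hve]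
    exact hadj _ _
  · intro e i j he hi hj
    simp only [Sum.elim_inr, hi, hj, if_true, one_ne_zero, if_false, hsidE e he]
    exact (hadj _ _).symm

end BlowupFamily

/-- `h'(n, p, q)` in terms of the Turán graph. -/
lemma hPrime_eq (n p q : ℕ) : hPrime n p q =
    (q - 1) * (n - (q - 1)) + (turanGraph (n - (q - 1)) p).edgeSet.ncard := by
  rw [hPrime, turanWith, ncard_edgeSet_join]
  simp

lemma ncard_edgeSet_le_familyEx {n : ℕ} {𝓕 : GraphFamily} {G : SimpleGraph (Fin n)}
    (h : FamilyFree 𝓕 G) : G.edgeSet.ncard ≤ familyEx n 𝓕 :=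
  le_csSup ((Set.finite_range fun G : SimpleGraph (Fin n) => G.edgeSet.ncard).subset (by
    rintro _ ⟨G, -, rfl⟩
    exact ⟨G, rfl⟩)).bddAbove ⟨G, h, rfl⟩

lemma exists_ncard_edgeSet_eq_familyEx {n : ℕ} {𝓕 : GraphFamily} {G : SimpleGraph (Fin n)}
    (h : FamilyFree 𝓕 G) :
    ∃ Q : SimpleGraph (Fin n), FamilyFree 𝓕 Q ∧ Q.edgeSet.ncard = familyEx n 𝓕 :=
  Nat.sSup_mem (s := {e | ∃ G : SimpleGraph (Fin n), FamilyFree 𝓕 G ∧ G.edgeSet.ncard = e})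
    ⟨_, G, h, rfl⟩ ((Set.finite_range fun G : SimpleGraph (Fin n) => G.edgeSet.ncard).subset (by
      rintro _ ⟨G, -, rfl⟩
      exact ⟨G, rfl⟩)).bddAbove

end

end BlowupTuran

/-! ### The theorem for edge blow-ups of trees -/

theorem theorem1p4 {V : Type*} [Fintype V] (T : SimpleGraph V) (hT : T.IsTree)
    (p : ℕ) (hp : 3 ≤ p)
    (A B : Set V) (hAB : T.IsBipartiteWith A B) (hcover : A ∪ B = Set.univ)
    (hcard : A.ncard ≤ B.ncard)
    (hδ : minDegreeOn T A = 1) (hα : B.ncard < T.indepNum)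
    (𝓜 : GraphFamily) (h𝓜 : 𝓜 = decompositionFamily (edgeBlowup T (p + 1)))
    (q : ℕ) (hq : q = familyIndepCoverNum 𝓜)
    (𝓑 : GraphFamily) (h𝓑 : 𝓑 = coveringFamily 𝓜) :
    ∃ n₀ : ℕ, ∀ n ≥ n₀,
      (edgeBlowup T (p + 1)).extremalNumber n = hPrime n p q + familyEx (q - 1) 𝓑 ∧
      ∀ G : SimpleGraph (Fin n),
        G ∈ graphEX n (edgeBlowup T (p + 1)) ↔
          ∃ Q ∈ familyEX (q - 1) 𝓑, Nonempty (G ≃g turanWith n p q Q) := by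
  classical
  obtain ⟨m, rfl⟩ : ∃ m, p = m + 1 := ⟨p - 1, by omega⟩
  have hm : 2 ≤ m := by omega
  change 𝓜 = decompositionFamily (edgeBlowup T (m + 2)) at h𝓜
  change ∃ n₀ : ℕ, ∀ n ≥ n₀,
      (edgeBlowup T (m + 2)).extremalNumber n = hPrime n (m + 1) q + familyEx (q - 1) 𝓑 ∧
      ∀ G : SimpleGraph (Fin n),
        G ∈ graphEX n (edgeBlowup T (m + 2)) ↔
          ∃ Q ∈ familyEX (q - 1) 𝓑, Nonempty (G ≃g turanWith n (m + 1) q Q)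
  have hA : ∀ u v, T.Adj u v → (u ∈ A ↔ v ∉ A) := fun u v => mem_iff_notMem_of_adj hAB
  obtain ⟨e⟩ : Nonempty T.edgeSet := by
    obtain ⟨v, -, hv⟩ := exists_ncard_neighborSet_eq_one hδ
    obtain ⟨w, hw⟩ := Set.nonempty_of_ncard_ne_zero (hv.trans_ne one_ne_zero)
    exact ⟨⟨s(v, w), hw⟩⟩
  have hχ : (edgeBlowup T (m + 2)).chromaticNumber.toNat - 2 = m := by
    rw [chromaticNumber_edgeBlowup hm hA e, ENat.toNat_natCast]
    omega
  have hL : edgeBlowup T (m + 2) ≠ ⊥ := fun h => by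
    obtain ⟨⟨a, b⟩, hab⟩ := e
    have := edgeBlowup_adj_inl_inl (k := m + 2) |>.2 hab
    rw [h] at this
    exact this
  have hmatch := edgeBlowup_isContained_join_matching hm hA
  have hbip : ∃ F ∈ 𝓜, F.2.IsBipartite := by
    obtain ⟨F, hF, ⟨f⟩⟩ := exists_mem_decompositionFamily_of_isContained hχ hmatch
    exact ⟨F, h𝓜 ▸ hF, (starForest_isBipartite _ _).of_hom f.toHom⟩
  obtain ⟨F, hF, X, hXc, hXi, hXq⟩ := exists_indepCover_family hbip
  rw [h𝓜] at hF
  obtain ⟨v, t, hFL⟩ := hF.1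
  rw [hχ] at hFL
  obtain ⟨C₀, hC₀, hCq₀⟩ := exists_indepSet_of_copy (by omega) hXc hXi hFL
  obtain ⟨C, hC, hCq, hsp⟩ :=
    exists_indepSet_special hT hAB hcover hcard hδ hC₀ (hCq₀.trans hXq.le)
  -- Positivity of `q` makes `q - 1` a genuine subtraction, so the `q` stars split into `r = q - 1`
  -- stars and the extra edge.
  have hq0 : 0 < familyIndepCoverNum 𝓜 := by
    rcases hsp with h | ⟨v, hv, -⟩
    · have := h.card_pos
      omega
    · have := Finset.card_pos.2 ⟨v, hv⟩
      omega
  subst hq h𝓑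
  have hstar := edgeBlowup_isContained_join_starForest hm hA hC
    (r := familyIndepCoverNum 𝓜 - 1) (by omega) hsp
  obtain ⟨n₀, hn₀⟩ := extremal_of_starForest (by omega) hL hmatch hstar
    (good := FamilyFree (coveringFamily 𝓜))
    (fun Q hQ => familyFree_of_free_join hχ (by omega) h𝓜 hq0 hQ)
    (fun Q hQ n => free_join_of_familyFree hχ h𝓜 hq0 hQ n)
    (fun Q hQ => ncard_edgeSet_le_familyEx hQ)
    (exists_ncard_edgeSet_eq_familyEx (familyFree_coveringFamily_bot hq0))
  refine ⟨n₀, fun n hn => ⟨?_, (hn₀ n hn).2⟩⟩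
  rw [hPrime_eq]
  exact (hn₀ n hn).1
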